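/- Let $n\ge 1$, let $\boldsymbol\mu=(\mu_1,\dots,\mu_n)\in\mathbb C^n$ with $\sum_{l}\mu_l=0$, and let $\boldsymbol m=(m_1,\dots,m_n)\in\mathbb Z^n$. Put $\boldsymbol e=(1,\dots,1)$ and $$G_{(\boldsymbol\mu,\boldsymbol m)}(s)=\prod_{l=1}^n i^{|m_l|}(2\pi)^{1-2(s-\mu_l)}\,\frac{\Gamma\left(s-\mu_l+\frac{|m_l|}2\right)}{\Gamma\left(1-s+\mu_l+\frac{|m_l|}2\right)},\qquad j_{(\boldsymbol\mu,\boldsymbol m)}(x)=\frac1{2\pi i}\int_{\mathcal C_{(\boldsymbol\mu,\boldsymbol m)}}G_{(\boldsymbol\mu,\boldsymbol m)}(s)\,x^{-2s}\,ds\quad(x>0),$$ where $\mathcal C_{(\boldsymbol\mu,\boldsymbol m)}$ is any polygonal contour running upwards through $\sigma-i\infty,\ \sigma-iT,\ \rho-iT,\ \rho+iT,\ \sigma+iT,\ \sigma+i\infty$ with $\sigma<\frac12+\frac1n\left(\mathrm{Re}\sum_l\mu_l-\frac12\right)$, $\rho>\max_l\left(\mathrm{Re}\,\mu_l-\frac{|m_l|}2\right)$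 and $T>\max_l|\mathrm{Im}\,\mu_l|$ (so that all poles of $G_{(\boldsymbol\mu,\boldsymbol m)}$ lie on its left). The complex Bessel kernel is $$J_{(\boldsymbol\mu,\boldsymbol m)}\left(xe^{i\phi}\right)=\frac1{2\pi}\sum_{k\in\mathbb Z}j_{(\boldsymbol\mu,\boldsymbol m+k\boldsymbol e)}(x)\,e^{ik\phi}\qquad(x>0,\ \phi\in\mathbb R).$$ For $\boldsymbol\lambda\in\mathbb C^n$, $1\le l\le n$ and $\zeta=re^{i\omega}$ on the universal cover of $\mathbb C\smallsetminus\{0\}$ (with $\zeta^a=e^{a(\log r+i\omega)}$), the Bessel function of the first kind of rank $n$ and positive sign is $$J_l(\zeta;+,\boldsymbol\lambda)=\sum_{j=0}^\infty\frac{i^{nj}\,\zeta^{\,n(-\lambda_l+j)}}{\prod_{k=1}^n\Gamma(\lambda_k-\lambda_l+j+1)}.$$ For a choice of sign $\varepsilon\in\{1,-1\}$ put $$S_l(\boldsymbol\mu,\boldsymbol m)=\prod_{k\ne l}\frac{(\varepsilon i)^{m_l-m_k}}{\sin\left(\pi\left(\mu_l-\mu_k+\frac\varepsilon2(m_l-m_k)\right)\right)}.$$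 Call $(\boldsymbol\mu,\boldsymbol m)$ generic if $2\mu_k-2\mu_l-|m_k-m_l|\notin2\mathbb Z$ for all $l\ne k$. Then, for every choice of the contours and of $\varepsilon$, and for all $x>0$ and $\phi\in\mathbb R$, the integrals $j_{(\boldsymbol\mu,\boldsymbol m+k\boldsymbol e)}(x)$ and the series $J_{(\boldsymbol\mu,\boldsymbol m)}(xe^{i\phi})$ converge absolutely, and if $(\boldsymbol\mu,\boldsymbol m)$ is generic, then with $z=xe^{i\phi}$, $z^{1/n}=x^{1/n}e^{i\phi/n}$ and $\bar z^{1/n}=x^{1/n}e^{-i\phi/n}$, $$J_{(\boldsymbol\mu,\boldsymbol m)}(z)=\left(2\pi^2\right)^{n-1}\sum_{l=1}^nS_l(\boldsymbol\mu,\boldsymbol m)\,J_l\left(2\pi z^{1/n};+,\boldsymbol\mu+\tfrac12\boldsymbol m\right)J_l\left(2\pi\bar z^{1/n};+,\boldsymbol\mu-\tfrac12\boldsymbol m\right).$$ The right hand side does not change when $\phi$ is replaced by $\phi+2\pi j$, $j\in\mathbb Z$. For arbitrary $(\boldsymbol\mu,\boldsymbol m)$, the points $\boldsymbol\mu'$ with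 $\sum_l\mu'_l=0$ and $(\boldsymbol\mu',\boldsymbol m)$ generic accumulate at (or include) $\boldsymbol\mu$, and $J_{(\boldsymbol\mu,\boldsymbol m)}(z)$ is the limit, as $\boldsymbol\mu'\to\boldsymbol\mu$ through such points, of the right hand side with $\boldsymbol\mu'$ in place of $\boldsymbol\mu$. -/

import Mathlib

open scoped Topology

noncomputable section

/-- The gamma factor `G_m(s) = i^{|m|} (2π)^{1-2s} Γ(s + |m|/2) / Γ(1 - s + |m|/2)`. At the poles of
the denominator the quotient is `0` in Lean, which is the value of the entire function `1/Γ`. -/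
def gammaFactor (m : ℤ) (s : ℂ) : ℂ :=
  Complex.I ^ m.natAbs * (2 * (Real.pi : ℂ)) ^ (1 - 2 * s) *
    (Complex.Gamma (s + (m.natAbs : ℂ) / 2) / Complex.Gamma (1 - s + (m.natAbs : ℂ) / 2))

/-- `G_{(μ,m)}(s) = ∏_l G_{m_l}(s - μ_l)`. -/
def gammaProd {n : ℕ} (μ : Fin n → ℂ) (m : Fin n → ℤ) (s : ℂ) : ℂ :=
  ∏ l, gammaFactor (m l) (s - μ l)

/-- An admissible Barnes-Mellin contour for the index `(μ, m)`: the upward directed polygonal line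
`σ - i∞ → σ - iT → ρ - iT → ρ + iT → σ + iT → σ + i∞`. The poles of `gammaProd μ m` are the points
`μ_l - |m_l|/2 - α` with `α ∈ ℕ`; they have real part `< ρ` and imaginary part in `(-T, T)`, so
they all lie on the left of the contour. The bound on `σ` makes the integral converge. -/
structure BarnesContour {n : ℕ} (μ : Fin n → ℂ) (m : Fin n → ℤ) where
  σ : ℝ
  ρ : ℝ
  T : ℝ
  σ_lt : σ < 1 / 2 + ((∑ l, μ l).re - 1 / 2) / n
  re_lt : ∀ l, (μ l).re - |(m l : ℝ)| / 2 < ρ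
  im_lt : ∀ l, |(μ l).im| < T

/-- Admissible contours exist for every index. -/
theorem BarnesContour.nonempty {n : ℕ} (μ : Fin n → ℂ) (m : Fin n → ℤ) :
    Nonempty (BarnesContour μ m) := by
  obtain ⟨a, ha⟩ := (Set.finite_range fun l => (μ l).re - |(m l : ℝ)| / 2).bddAbove
  obtain ⟨b, hb⟩ := (Set.finite_range fun l => |(μ l).im|).bddAbove
  exact ⟨⟨1 / 2 + ((∑ l, μ l).re - 1 / 2) / n - 1, a + 1, b + 1, by linarith,
    fun l => by linarith [ha ⟨l, rfl⟩], fun l => by linarith [hb ⟨l, rfl⟩]⟩⟩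

/-- The contour integral `∫_C f(s) ds` along the polygonal line described above. -/
def BarnesContour.integral {n : ℕ} {μ : Fin n → ℂ} {m : Fin n → ℤ} (C : BarnesContour μ m)
    (f : ℂ → ℂ) : ℂ :=
  (∫ t in Set.Iic (-C.T), f (C.σ + t * Complex.I) * Complex.I) +
    (∫ r in C.σ..C.ρ, f (r - C.T * Complex.I)) +
    (∫ t in (-C.T)..C.T, f (C.ρ + t * Complex.I) * Complex.I) +
    (∫ r in C.ρ..C.σ, f (r + C.T * Complex.I)) +
    ∫ t in Set.Ioi C.T, f (C.σ + t * Complex.I) * Complex.I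

/-- Absolute convergence of `∫_C f(s) ds` along the five pieces of the contour. -/
def BarnesContour.AbsConverges {n : ℕ} {μ : Fin n → ℂ} {m : Fin n → ℤ} (C : BarnesContour μ m)
    (f : ℂ → ℂ) : Prop :=
  MeasureTheory.IntegrableOn (fun t : ℝ => f (C.σ + t * Complex.I)) (Set.Iic (-C.T)) ∧
    IntervalIntegrable (fun r : ℝ => f (r - C.T * Complex.I)) MeasureTheory.volume C.σ C.ρ ∧
    IntervalIntegrable (fun t : ℝ => f (C.ρ + t * Complex.I)) MeasureTheory.volume (-C.T) C.T ∧
    IntervalIntegrable (fun r : ℝ => f (r + C.T * Complex.I)) MeasureTheory.volume C.ρ C.σ ∧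
    MeasureTheory.IntegrableOn (fun t : ℝ => f (C.σ + t * Complex.I)) (Set.Ioi C.T)

/-- The integrand `G_{(μ,m)}(s) x^{-2s}`, for `x > 0`. -/
def mellinIntegrand {n : ℕ} (μ : Fin n → ℂ) (m : Fin n → ℤ) (x : ℝ) (s : ℂ) : ℂ :=
  gammaProd μ m s * (x : ℂ) ^ (-2 * s)

/-- The Bessel kernel `j_{(μ,m)}(x) = (1/2πi) ∫_C G_{(μ,m)}(s) x^{-2s} ds`, for `x > 0`. -/
def radialBesselKernel {n : ℕ} {μ : Fin n → ℂ} {m : Fin n → ℤ} (C : BarnesContour μ m)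
    (x : ℝ) : ℂ :=
  1 / (2 * (Real.pi : ℂ) * Complex.I) * C.integral (mellinIntegrand μ m x)

/-- The `k`-th term `(1/2π) j_{(μ, m + k e)}(|z|) [z]^k` of the complex Bessel kernel, where
`e = (1, ..., 1)` and `[z] = z / |z|`. -/
def complexBesselTerm {n : ℕ} {μ : Fin n → ℂ} {m : Fin n → ℤ}
    (C : ∀ k : ℤ, BarnesContour μ (fun l => m l + k)) (z : ℂ) (k : ℤ) : ℂ :=
  1 / (2 * (Real.pi : ℂ)) * radialBesselKernel (C k) ‖z‖ * (z / (‖z‖ : ℂ)) ^ k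

/-- The complex Bessel kernel `J_{(μ,m)}(z) = (1/2π) ∑_{k ∈ ℤ} j_{(μ, m + k e)}(|z|) [z]^k`,
computed with the contours `C k`. -/
def complexBesselKernel {n : ℕ} {μ : Fin n → ℂ} {m : Fin n → ℤ}
    (C : ∀ k : ℤ, BarnesContour μ (fun l => m l + k)) (z : ℂ) : ℂ :=
  ∑' k : ℤ, complexBesselTerm C z k

/-- The power `ζ^a = exp (a (log r + i ω))` of the point `ζ = r e^{iω}`, `r > 0`, `ω ∈ ℝ`, of the
universal cover of the punctured plane. -/
def coverPow (r ω : ℝ) (a : ℂ) : ℂ :=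
  Complex.exp (a * ((Real.log r : ℂ) + (ω : ℂ) * Complex.I))

/-- The Bessel function of the first kind `J_l(ζ; ς, lam)` of rank `n`, sign `ς ∈ {1, -1}` and index
`lam ∈ ℂⁿ`, at the point `ζ = r e^{iω}` of the universal cover of the punctured plane:
`∑_{j ≥ 0} (ς iⁿ)^j ζ^{n(-lam_l + j)} / ∏_k Γ(lam_k - lam_l + j + 1)`.
Since `Γ` is `0` at its poles and `0⁻¹ = 0` in Lean, the inverse of `Γ` below is the entire
function `1/Γ`. -/
def besselFirstKind {n : ℕ} (ς : ℤˣ) (lam : Fin n → ℂ) (l : Fin n) (r ω : ℝ) : ℂ :=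
  ∑' j : ℕ, (((ς : ℤ) : ℂ) * Complex.I ^ n) ^ j * coverPow r ω (n * (-lam l + j)) *
    (∏ k, Complex.Gamma (lam k - lam l + j + 1))⁻¹

/-- `S_l(μ,m) = ∏_{k ≠ l} (± i)^{m_l - m_k} sin (π (μ_l - μ_k ± (m_l - m_k)/2))⁻¹`, with `ε = ±1` as
the common choice of the two signs. -/
def connectionCoeff {n : ℕ} (ε : ℤˣ) (μ : Fin n → ℂ) (m : Fin n → ℤ) (l : Fin n) : ℂ :=
  ∏ k ∈ Finset.univ.erase l, (((ε : ℤ) : ℂ) * Complex.I) ^ (m l - m k) *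
    (Complex.sin (Real.pi * (μ l - μ k + ((ε : ℤ) : ℂ) * (((m l - m k : ℤ) : ℂ) / 2))))⁻¹

/-- The right hand side of the connection formula at `z = x e^{iφ}`:
`(2π²)^{n-1} ∑_l S_l(μ,m) J_l(2π z^{1/n}; +, μ + m/2) J_l(2π z̄^{1/n}; +, μ - m/2)`,
with `z^{1/n} = x^{1/n} e^{iφ/n}` and `z̄^{1/n} = x^{1/n} e^{-iφ/n}`. -/
def connectionRHS {n : ℕ} (ε : ℤˣ) (μ : Fin n → ℂ) (m : Fin n → ℤ) (x φ : ℝ) : ℂ :=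
  (2 * (Real.pi : ℂ) ^ 2) ^ (n - 1) * ∑ l, connectionCoeff ε μ m l *
    (besselFirstKind 1 (fun k => μ k + (m k : ℂ) / 2) l
        (2 * Real.pi * x ^ ((1 : ℝ) / n)) (φ / n) *
      besselFirstKind 1 (fun k => μ k - (m k : ℂ) / 2) l
        (2 * Real.pi * x ^ ((1 : ℝ) / n)) (-φ / n))

/-- The equivalence relation `(a, m) ∼ (a', m')` iff `a' - a - |m' - m| ∈ 2ℤ`, on `ℂ × ℤ`. -/
def indexEquiv (p q : ℂ × ℤ) : Prop :=
  ∃ j : ℤ, q.1 - p.1 - ((|q.2 - p.2| : ℤ) : ℂ) = 2 * (j : ℂ)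

/-- `(μ, m)` is generic: the pairs `(2μ_l, m_l)` are pairwise inequivalent. -/
def IsGenericIndex {n : ℕ} (μ : Fin n → ℂ) (m : Fin n → ℤ) : Prop :=
  ∀ l k : Fin n, l ≠ k → ¬ indexEquiv (2 * μ l, m l) (2 * μ k, m k)

/-- The `μ` in the hyperplane `∑ μ_l = 0` for which `(μ, m)` is generic. -/
def genericSet {n : ℕ} (m : Fin n → ℤ) : Set (Fin n → ℂ) :=
  {μ | ∑ l, μ l = 0 ∧ IsGenericIndex μ m}

end

/-!
The connection formula is a residue computation. For a generic index all poles of the integrand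
`G_{(μ, m + k e)}(s) x^{-2s}` are simple, and moving the contour to `Re s = -∞` writes the radial
kernel as the sum of the residues (`radialBesselKernel_eq_sum_residues`): the contour integral is a
line integral plus an integral over the boundary of a rectangle, and the line integral is at least
halved by each unit step to the left, by the functional equation of `Γ`.

The poles attached to `μ_l` are `μ_l - |m_l + k| / 2 - α` with `α ∈ ℕ`. Put `a - b = m_l + k` and
`min a b = α`. Then the pole is `μ_l - (a + b) / 2`, and by the reflection formula the residue there,
multiplied by `e^{ikφ}`, is up to a constant independent of `a` and `b` the `a`-th term of one Bessel
series of the first kind times the `b`-th term of another (`tendsto_sub_mul_mellinIntegrand`). Since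
`(k, α) ↦ (a, b)` is a bijection of `ℤ × ℕ` with `ℕ × ℕ`, summing over `k` and `α` gives the product
of the two series (`hasSum_complexBesselTerm`). The left hand side depends on `φ` only modulo `2π`,
hence so does the right hand side.

For arbitrary indices it remains to see that the kernel is continuous in `μ`
(`summable_and_tendsto_complexBesselKernel`) and that generic indices are dense
(`neBot_nhdsWithin_genericSet`). The kernel does not depend on the contours
(`BarnesContour.integral_eq_integral`), so they may be chosen uniformly for bounded `μ`, with a
straight vertical line once `|k|` is large. Both the convergence of the integrals and the dominated
convergence argument rest on the estimate `|Γ(z)| ≤ K |z|^{-d} |Γ(z + d)|` for `Re z ≥ 1`, `d ≥ 0`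
(`exists_norm_Gamma_le_mul_rpow`), which replaces Stirling's formula. It follows from Euler's product
for `Γ`, because `|1 + θ q| ≤ |1 + q|^θ exp(3 |q|² / 2)` for `0 ≤ θ ≤ 1` and `Re q ≥ 0`, and the
factors `|1 + q|^θ` telescope.
-/

/-! ### Growth of the gamma function on vertical lines -/

theorem norm_one_add_mul_le {q : ℂ} (hq : 0 ≤ q.re) {θ : ℝ} (h0 : 0 ≤ θ) (h1 : θ ≤ 1) :
    ‖1 + θ * q‖ ≤ ‖1 + q‖ ^ θ * Real.exp (3 / 2 * ‖q‖ ^ 2) := by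
  have hq2 : ‖q‖ ^ 2 = q.re ^ 2 + q.im ^ 2 := by
    rw [Complex.sq_norm, Complex.normSq_apply]; ring
  have hre : q.re ^ 2 ≤ ‖q‖ ^ 2 := by rw [hq2]; nlinarith [sq_nonneg q.im]
  have hA : ‖1 + θ * q‖ ≤ Real.exp (θ * q.re + ‖q‖ ^ 2 / 2) := by
    refine le_of_sq_le_sq ?_ (Real.exp_pos _).le
    rw [← Real.exp_nat_mul, Complex.sq_norm, Complex.normSq_apply]
    refine le_trans ?_ (Real.add_one_le_exp _)
    simp only [Complex.add_re, Complex.one_re, Complex.mul_re, Complex.ofReal_re, Complex.ofReal_im,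
      Complex.add_im, Complex.one_im, Complex.mul_im]
    have : θ ^ 2 * ‖q‖ ^ 2 ≤ ‖q‖ ^ 2 :=
      mul_le_of_le_one_left (sq_nonneg _) (pow_le_one₀ h0 h1)
    rw [hq2] at this ⊢
    push_cast
    nlinarith
  have hB : Real.exp (q.re - q.re ^ 2) ≤ ‖1 + q‖ := by
    refine le_of_sq_le_sq ?_ (norm_nonneg _)
    rw [← Real.exp_nat_mul, Complex.sq_norm, Complex.normSq_apply]
    have h2 : Real.exp (2 * q.re - 2 * q.re ^ 2) ≤ 1 + 2 * q.re := by
      rw [← Real.le_log_iff_exp_le (by linarith)]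
      refine le_trans ?_ (Real.le_log_one_add_of_nonneg (by linarith : 0 ≤ 2 * q.re))
      rw [le_div_iff₀ (by linarith)]
      nlinarith [pow_nonneg hq 3]
    push_cast
    simp only [Complex.add_re, Complex.one_re, Complex.add_im, Complex.one_im]
    calc _ = Real.exp (2 * q.re - 2 * q.re ^ 2) := by congr 1; ring
      _ ≤ _ := h2
      _ ≤ _ := by nlinarith [sq_nonneg q.re, sq_nonneg q.im]
  calc ‖1 + θ * q‖ ≤ Real.exp (θ * q.re + ‖q‖ ^ 2 / 2) := hA
    _ ≤ Real.exp ((q.re - q.re ^ 2) * θ + 3 / 2 * ‖q‖ ^ 2) := by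
      apply Real.exp_le_exp.2
      have : q.re ^ 2 * θ ≤ q.re ^ 2 := mul_le_of_le_one_right (sq_nonneg _) h1
      nlinarith
    _ = Real.exp (q.re - q.re ^ 2) ^ θ * Real.exp (3 / 2 * ‖q‖ ^ 2) := by
      rw [Real.exp_add, Real.exp_mul]
    _ ≤ _ := by gcongr

theorem norm_add_le_mul_rpow {w : ℂ} (hw : 0 < w.re) {θ : ℝ} (h0 : 0 ≤ θ) (h1 : θ ≤ 1) :
    ‖w + θ‖ ≤ ‖w‖ * (‖w + 1‖ / ‖w‖) ^ θ * Real.exp (3 / 2 * (1 / w.re ^ 2)) := by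
  have hw0 : w ≠ 0 := by rintro rfl; simp at hw
  have hn : 0 < ‖w‖ := norm_pos_iff.2 hw0
  have hle : w.re ≤ ‖w‖ := Complex.re_le_norm w
  have key := norm_one_add_mul_le (q := w⁻¹)
    (by rw [Complex.inv_re]; exact div_nonneg hw.le (Complex.normSq_nonneg _)) h0 h1
  have e1 : ‖w + θ‖ = ‖w‖ * ‖1 + θ * w⁻¹‖ := by
    rw [← norm_mul]; congr 1; field_simp
  have e2 : ‖1 + w⁻¹‖ = ‖w + 1‖ / ‖w‖ := by
    rw [← norm_div]; congr 1; field_simp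
  rw [e2] at key
  rw [e1, mul_assoc]
  gcongr
  refine key.trans ?_
  gcongr
  rw [norm_inv, inv_pow, ← one_div]
  gcongr

theorem prod_norm_add_le {z : ℂ} (hz : 1 ≤ z.re) {θ : ℝ} (h0 : 0 ≤ θ) (h1 : θ ≤ 1) (N : ℕ) :
    ∏ j ∈ Finset.range N, ‖z + θ + j‖ ≤ (∏ j ∈ Finset.range N, ‖z + j‖) *
      (‖z + N‖ / ‖z‖) ^ θ * Real.exp (3 / 2 * ∑ j ∈ Finset.range N, 1 / ((j : ℝ) + 1) ^ 2) := by
  have hpos : ∀ j : ℕ, 0 < ‖z + j‖ := fun j => by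
    rw [norm_pos_iff]
    intro h
    have := congrArg Complex.re h
    simp at this
    have : (0 : ℝ) ≤ j := j.cast_nonneg
    linarith
  have hz0 : 0 < ‖z‖ := by simpa using hpos 0
  induction N with
  | zero => simp [div_self hz0.ne']
  | succ N ih =>
    rw [Finset.prod_range_succ, Finset.prod_range_succ, Finset.sum_range_succ, mul_add, Real.exp_add]
    have hre : (N : ℝ) + 1 ≤ (z + N).re := by simp; linarith
    have hN : (0 : ℝ) ≤ N := N.cast_nonneg
    have step := norm_add_le_mul_rpow (w := z + N) (by linarith) h0 h1
    have e : z + θ + N = z + N + θ := by ring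
    have hd : (‖z + (N + 1 : ℕ)‖ / ‖z‖) ^ θ = (‖z + N‖ / ‖z‖) ^ θ * (‖z + N + 1‖ / ‖z + N‖) ^ θ := by
      rw [← Real.mul_rpow (by positivity) (by positivity)]
      congr 1
      have := (hpos N).ne'
      push_cast
      rw [← add_assoc]
      field_simp
    rw [e, hd]
    calc _ ≤ ((∏ j ∈ Finset.range N, ‖z + j‖) * (‖z + N‖ / ‖z‖) ^ θ *
          Real.exp (3 / 2 * ∑ j ∈ Finset.range N, 1 / ((j : ℝ) + 1) ^ 2)) *
          (‖z + N‖ * (‖z + N + 1‖ / ‖z + N‖) ^ θ * Real.exp (3 / 2 * (1 / ((N : ℝ) + 1) ^ 2))) := by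
          refine mul_le_mul ih (step.trans ?_) (norm_nonneg _) (by positivity)
          gcongr
      _ = _ := by ring

theorem norm_Gamma_le_of_le_one : ∃ K : ℝ, 0 < K ∧ ∀ z : ℂ, 1 ≤ z.re → ∀ θ : ℝ, 0 ≤ θ → θ ≤ 1 →
    ‖Complex.Gamma z‖ ≤ K * ‖z‖ ^ (-θ) * ‖Complex.Gamma (z + θ)‖ := by
  have hs : Summable fun j : ℕ => 1 / ((j : ℝ) + 1) ^ 2 := by
    have := (summable_nat_add_iff 1).2 (Real.summable_one_div_nat_pow.2 (by norm_num : 1 < 2))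
    simpa using this
  refine ⟨Real.exp (3 / 2 * ∑' j : ℕ, 1 / ((j : ℝ) + 1) ^ 2), Real.exp_pos _,
    fun z hz θ h0 h1 => ?_⟩
  set K := Real.exp (3 / 2 * ∑' j : ℕ, 1 / ((j : ℝ) + 1) ^ 2) with hK
  have hpos : ∀ (y : ℂ), 1 ≤ y.re → ∀ j : ℕ, 0 < ‖y + j‖ := fun y hy j => by
    rw [norm_pos_iff]
    intro h
    have := congrArg Complex.re h
    simp at this
    have : (0 : ℝ) ≤ j := j.cast_nonneg
    linarith
  have hz0 : 0 < ‖z‖ := by simpa using hpos z hz 0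
  have hb : ∀ n : ℕ, 1 ≤ n → ‖Complex.GammaSeq z n‖ ≤
      (K * ‖z‖ ^ (-θ) * ‖Complex.GammaSeq (z + θ) n‖) * (‖z + (n + 1 : ℕ)‖ / n) ^ θ := by
    intro n hn
    have hn0 : (0 : ℝ) < n := by exact_mod_cast hn
    have hp := prod_norm_add_le hz h0 h1 (n + 1)
    have hsum : Real.exp (3 / 2 * ∑ j ∈ Finset.range (n + 1), 1 / ((j : ℝ) + 1) ^ 2) ≤ K := by
      rw [hK]
      gcongr
      exact hs.sum_le_tsum _ (fun _ _ => by positivity)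
    unfold Complex.GammaSeq
    simp only [norm_mul, norm_div, norm_prod, Complex.norm_natCast]
    have e1 : ‖(n : ℂ) ^ z‖ = (n : ℝ) ^ z.re := by
      rw [← Complex.ofReal_natCast, Complex.norm_cpow_eq_rpow_re_of_pos hn0]
    have e2 : ‖(n : ℂ) ^ (z + θ)‖ = (n : ℝ) ^ z.re * (n : ℝ) ^ θ := by
      rw [← Complex.ofReal_natCast, Complex.norm_cpow_eq_rpow_re_of_pos hn0,
        ← Real.rpow_add hn0]; simp
    rw [e1, e2]
    have hP : 0 < ∏ j ∈ Finset.range (n + 1), ‖z + j‖ := Finset.prod_pos fun j _ => hpos z hz j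
    have hQ : 0 < ∏ j ∈ Finset.range (n + 1), ‖z + θ + j‖ :=
      Finset.prod_pos fun j _ => hpos _ (by simp; linarith) j
    have hp2 := hp.trans (mul_le_mul_of_nonneg_left hsum (by positivity))
    rw [div_le_iff₀ hP]
    rw [Real.div_rpow (norm_nonneg _) hz0.le] at hp2
    rw [Real.div_rpow (norm_nonneg _) hn0.le, Real.rpow_neg hz0.le]
    have hzt : 0 < ‖z‖ ^ θ := Real.rpow_pos_of_pos hz0 _
    have hnt : 0 < (n : ℝ) ^ θ := Real.rpow_pos_of_pos hn0 _
    set P := ∏ j ∈ Finset.range (n + 1), ‖z + j‖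
    set Q := ∏ j ∈ Finset.range (n + 1), ‖z + θ + j‖
    have : (n : ℝ) ^ z.re * (n.factorial : ℝ) * Q ≤ (n : ℝ) ^ z.re * (n.factorial : ℝ) *
        (P * (‖z + (n + 1 : ℕ)‖ ^ θ / ‖z‖ ^ θ) * K) := by gcongr
    calc (n : ℝ) ^ z.re * (n.factorial : ℝ)
        = (n : ℝ) ^ z.re * (n.factorial : ℝ) * Q / Q := by field_simp
      _ ≤ (n : ℝ) ^ z.re * (n.factorial : ℝ) *
        (P * (‖z + (n + 1 : ℕ)‖ ^ θ / ‖z‖ ^ θ) * K) / Q := by gcongr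
      _ = _ := by field_simp
  have hlim : Filter.Tendsto (fun n : ℕ => (‖z + (n + 1 : ℕ)‖ / n) ^ θ) Filter.atTop (𝓝 1) := by
    have h1 : Filter.Tendsto (fun n : ℕ => ‖(z + 1) * ((n : ℂ))⁻¹ + 1‖) Filter.atTop (𝓝 1) := by
      have := ((tendsto_inv_atTop_nhds_zero_nat (𝕜 := ℂ)).const_mul (z + 1)).add_const 1
      simpa using this.norm
    have h2 : Filter.Tendsto (fun n : ℕ => ‖z + (n + 1 : ℕ)‖ / n) Filter.atTop (𝓝 1) := by
      refine h1.congr' ?_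
      filter_upwards [Filter.eventually_ge_atTop 1] with n hn
      have hn0 : (n : ℂ) ≠ 0 := by exact_mod_cast (by omega : n ≠ 0)
      have : (n : ℝ) = ‖(n : ℂ)‖ := by simp
      rw [this, ← norm_div]
      congr 1
      push_cast
      field_simp
      ring
    simpa using h2.rpow_const (p := θ) (Or.inl one_ne_zero)
  have hL := (Complex.GammaSeq_tendsto_Gamma z).norm
  have hR := ((Complex.GammaSeq_tendsto_Gamma (z + θ)).norm.const_mul (K * ‖z‖ ^ (-θ))).mul hlim
  rw [mul_one] at hR
  exact le_of_tendsto_of_tendsto hL hR (Filter.eventually_atTop.2 ⟨1, hb⟩)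

/-- A Stirling-free comparison of two values of `Γ` with the same imaginary part: up to a uniform
constant, moving `z` to the right by `d ≥ 0` multiplies `|Γ|` by at least `|z|^d`. -/
theorem exists_norm_Gamma_le_mul_rpow : ∃ K : ℝ, 0 < K ∧ ∀ z : ℂ, 1 ≤ z.re → ∀ d : ℝ, 0 ≤ d →
    ‖Complex.Gamma z‖ ≤ K * ‖z‖ ^ (-d) * ‖Complex.Gamma (z + d)‖ := by
  obtain ⟨K, hK, h⟩ := norm_Gamma_le_of_le_one
  refine ⟨K, hK, fun z hz d hd => ?_⟩
  obtain ⟨N, θ, h0, h1, rfl⟩ : ∃ (N : ℕ) (θ : ℝ), 0 ≤ θ ∧ θ ≤ 1 ∧ d = N + θ :=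
    ⟨⌊d⌋₊, d - ⌊d⌋₊, sub_nonneg.2 (Nat.floor_le hd), by linarith [Nat.lt_floor_add_one d], by ring⟩
  have hz0 : 0 < ‖z‖ := lt_of_lt_of_le (by linarith) (Complex.re_le_norm z)
  have hN : ∀ N : ℕ, ‖z‖ ^ N * ‖Complex.Gamma (z + θ)‖ ≤ ‖Complex.Gamma (z + θ + N)‖ := by
    intro N
    induction N with
    | zero => simp
    | succ N ih =>
      have hre : z.re ≤ (z + θ + N).re := by
        simp; have : (0 : ℝ) ≤ N := N.cast_nonneg
        linarith
      have hne : z + θ + N ≠ 0 := fun h0 => by rw [h0] at hre; simp at hre; linarith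
      have e : z + θ + (N + 1 : ℕ) = z + θ + N + 1 := by push_cast; ring
      rw [e, Complex.Gamma_add_one _ hne, norm_mul, pow_succ']
      have hle : ‖z‖ ≤ ‖z + θ + N‖ := by
        refine le_of_sq_le_sq ?_ (norm_nonneg _)
        rw [Complex.sq_norm, Complex.sq_norm, Complex.normSq_apply, Complex.normSq_apply]
        have : (z + θ + N).im = z.im := by simp
        rw [this]
        nlinarith
      rw [mul_assoc]
      exact mul_le_mul hle ih (by positivity) (norm_nonneg _)
  have h2 := hN N
  have e : z + ((N + θ : ℝ) : ℂ) = z + θ + N := by push_cast; ring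
  rw [e]
  refine (h z hz θ h0 h1).trans ?_
  rw [neg_add, Real.rpow_add hz0, Real.rpow_neg hz0.le (N : ℝ), Real.rpow_natCast]
  calc K * ‖z‖ ^ (-θ) * ‖Complex.Gamma (z + θ)‖
      = K * ((‖z‖ ^ N)⁻¹ * ‖z‖ ^ (-θ)) * (‖z‖ ^ N * ‖Complex.Gamma (z + θ)‖) := by field_simp
    _ ≤ _ := by gcongr

theorem abs_im_pow_mul_norm_Gamma_le {z : ℂ} (hz : z.im ≠ 0) (M : ℕ) :
    |z.im| ^ M * ‖Complex.Gamma z‖ ≤ ‖Complex.Gamma (z + M)‖ := by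
  induction M with
  | zero => simp
  | succ M ih =>
    have hne : z + M ≠ 0 := fun h0 => hz (by simpa using congrArg Complex.im h0)
    have e : z + (M + 1 : ℕ) = z + M + 1 := by push_cast; ring
    rw [e, Complex.Gamma_add_one _ hne, norm_mul, pow_succ', mul_assoc]
    refine mul_le_mul ?_ ih (by positivity) (norm_nonneg _)
    simpa using Complex.abs_im_le_norm (z + M)

theorem norm_Gamma_add_nat_le {z : ℂ} (hz : z.im ≠ 0) {B : ℝ} (N : ℕ) (hB : ‖z‖ + N ≤ B) :
    ‖Complex.Gamma (z + N)‖ ≤ B ^ N * ‖Complex.Gamma z‖ := by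
  induction N with
  | zero => simp
  | succ N ih =>
    have hne : z + N ≠ 0 := fun h0 => hz (by simpa using congrArg Complex.im h0)
    have e : z + (N + 1 : ℕ) = z + N + 1 := by push_cast; ring
    push_cast at hB
    have hB0 : 0 ≤ B := le_trans (by positivity) hB
    rw [e, Complex.Gamma_add_one _ hne, norm_mul, pow_succ', mul_assoc]
    refine mul_le_mul ?_ (ih (by linarith)) (norm_nonneg _) hB0
    refine (norm_add_le _ _).trans ?_
    simp only [Complex.norm_natCast]
    linarith

theorem norm_Gamma_conj (z : ℂ) : ‖Complex.Gamma ((starRingEnd ℂ) z)‖ = ‖Complex.Gamma z‖ := by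
  rw [Complex.Gamma_conj, Complex.norm_conj]

/-- Uniform vertical growth: `Γ(w + a) / Γ(1 - w + a)` has size `|Im w| ^ (2 Re w - 1)`. -/
theorem exists_norm_Gamma_le_of_one_le_im (a D : ℝ) (ha : 0 ≤ a) (hD : 0 ≤ D) :
    ∃ C : ℝ, 0 < C ∧ ∀ w : ℂ, |w.re| ≤ D → 1 ≤ |w.im| →
      ‖Complex.Gamma (w + a)‖ ≤
        C * |w.im| ^ (2 * w.re - 1) * ‖Complex.Gamma (1 - w + a)‖ := by
  obtain ⟨K, hK, hS⟩ := exists_norm_Gamma_le_mul_rpow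
  obtain ⟨M, hM⟩ := exists_nat_ge (D + 1)
  obtain ⟨N, hN⟩ := exists_nat_ge (2 * D + M)
  set B : ℝ := 2 + D + a + N with hB
  have hB0 : 0 < B := by positivity
  refine ⟨K * B ^ N, by positivity, fun w hw hv => ?_⟩
  have hv0 : 0 < |w.im| := by linarith
  have him : w.im ≠ 0 := abs_pos.1 hv0
  obtain ⟨hw1, hw2⟩ := abs_le.1 hw
  set v := |w.im| with hvdef
  -- Conjugation gives the two arguments the same imaginary part; integer shifts by `M` and `N` then
  -- move them to the region where the comparison of `Γ`-values applies.
  set y : ℂ := 1 - (starRingEnd ℂ) w + a with hy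
  have hyim : y.im = w.im := by simp [hy]
  have hynorm : ‖Complex.Gamma (1 - w + a)‖ = ‖Complex.Gamma y‖ := by
    rw [← norm_Gamma_conj]; simp [hy]
  set z : ℂ := w + a + M with hz
  set d : ℝ := 1 - 2 * w.re + N - M with hd
  have hzd : z + d = y + N := by
    apply Complex.ext
    · simp [hz, hy, hd]; ring
    · simp [hz, hy, hd]
  have h1 := abs_im_pow_mul_norm_Gamma_le (z := w + a) (by simpa using him) M
  simp only [Complex.add_im, Complex.ofReal_im, add_zero] at h1
  have h2 := hS z (by simp [hz]; linarith) d (by simp only [hd]; linarith)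
  have h3 := norm_Gamma_add_nat_le (z := y) (B := B * v) (by rw [hyim]; exact him) N (by
    have h4 := Complex.norm_le_abs_re_add_abs_im y
    have h5 : |y.re| ≤ 1 + D + a := by
      simp only [hy, Complex.add_re, Complex.sub_re, Complex.one_re, Complex.conj_re,
        Complex.ofReal_re, abs_le]
      constructor <;> linarith
    rw [hyim, ← hvdef] at h4
    have : (1 + D + a + N) * 1 ≤ (1 + D + a + N) * v := by gcongr
    rw [hB]
    nlinarith)
  rw [hzd] at h2
  have hzn : v ≤ ‖z‖ := by
    have := Complex.abs_im_le_norm z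
    simpa [hz] using this
  have hzv : ‖z‖ ^ (-d) ≤ v ^ (-d) :=
    Real.rpow_le_rpow_of_nonpos hv0 hzn (by simp only [hd]; linarith)
  rw [hynorm]
  have h6 : v ^ M * ‖Complex.Gamma (w + a)‖ ≤ K * v ^ (-d) * ((B * v) ^ N * ‖Complex.Gamma y‖) := by
    refine h1.trans (h2.trans ?_)
    gcongr
  have h7 : v ^ (2 * w.re - 1) = (v ^ M)⁻¹ * v ^ (-d) * v ^ N := by
    rw [← Real.rpow_natCast, ← Real.rpow_natCast, ← Real.rpow_neg hv0.le, ← Real.rpow_add hv0,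
      ← Real.rpow_add hv0]
    congr 1
    simp only [hd]; ring
  have hvM : 0 < v ^ M := by positivity
  calc ‖Complex.Gamma (w + a)‖ = (v ^ M)⁻¹ * (v ^ M * ‖Complex.Gamma (w + a)‖) := by field_simp
    _ ≤ (v ^ M)⁻¹ * (K * v ^ (-d) * ((B * v) ^ N * ‖Complex.Gamma y‖)) := by gcongr
    _ = _ := by rw [h7, mul_pow]; ring

theorem differentiableAt_gammaFactor {m : ℤ} {w : ℂ}
    (h : ∀ α : ℕ, w + (m.natAbs : ℂ) / 2 ≠ -α) : DifferentiableAt ℂ (gammaFactor m) w := by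
  unfold gammaFactor
  have hpi : (2 * (Real.pi : ℂ)) ≠ 0 := by simp [Real.pi_ne_zero]
  have h1 : DifferentiableAt ℂ (fun s : ℂ => Complex.Gamma (s + (m.natAbs : ℂ) / 2)) w :=
    (Complex.differentiableAt_Gamma _ h).comp (f := fun s : ℂ => s + (m.natAbs : ℂ) / 2) w
      (by fun_prop)
  have h2 : DifferentiableAt ℂ (fun s : ℂ => (Complex.Gamma (1 - s + (m.natAbs : ℂ) / 2))⁻¹) w :=
    (Complex.differentiable_one_div_Gamma _).comp (f := fun s : ℂ => 1 - s + (m.natAbs : ℂ) / 2) w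
      (by fun_prop)
  have h3 : DifferentiableAt ℂ (fun s : ℂ => (2 * (Real.pi : ℂ)) ^ (1 - 2 * s)) w :=
    DifferentiableAt.const_cpow (by fun_prop) (Or.inl hpi)
  simp only [div_eq_mul_inv] at h1 h2 ⊢
  exact (h3.const_mul _).mul (h1.mul h2)

theorem norm_gammaFactor (m : ℤ) (w : ℂ) : ‖gammaFactor m w‖ = (2 * Real.pi) ^ (1 - 2 * w.re) *
    (‖Complex.Gamma (w + (m.natAbs : ℂ) / 2)‖ / ‖Complex.Gamma (1 - w + (m.natAbs : ℂ) / 2)‖) := by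
  unfold gammaFactor
  have : (2 * (Real.pi : ℂ)) = ((2 * Real.pi : ℝ) : ℂ) := by push_cast; ring
  rw [norm_mul, norm_mul, norm_pow, Complex.norm_I, one_pow, one_mul, norm_div, this,
    Complex.norm_cpow_eq_rpow_re_of_pos (by positivity)]
  simp

theorem two_pi_rpow_le {D u : ℝ} (h : |u| ≤ D) :
    (2 * Real.pi) ^ (1 - 2 * u) ≤ (2 * Real.pi) ^ (1 + 2 * D) := by
  apply Real.rpow_le_rpow_of_exponent_le
  · linarith [Real.pi_gt_three]
  · linarith [(abs_le.1 h).1]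

/-- Bound for a gamma factor in a vertical strip, at distance `≥ δ` from its poles. -/
theorem exists_norm_gammaFactor_le (m : ℤ) (D δ : ℝ) (hD : 0 ≤ D) (hδ : 0 < δ) :
    ∃ C : ℝ, 0 < C ∧ ∀ w : ℂ, |w.re| ≤ D → (δ ≤ w.re + (m.natAbs : ℝ) / 2 ∨ δ ≤ |w.im|) →
      ‖gammaFactor m w‖ ≤ C * (1 + |w.im|) ^ (2 * w.re - 1) := by
  obtain ⟨C₁, hC₁, h₁⟩ := exists_norm_Gamma_le_of_one_le_im ((m.natAbs : ℝ) / 2) D (by positivity) hD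
  have hcpt : IsCompact ((Set.Icc (-D) D ×ℂ Set.Icc (-1) 1) ∩
      {w : ℂ | δ ≤ w.re + (m.natAbs : ℝ) / 2 ∨ δ ≤ |w.im|}) := by
    apply (IsCompact.reProdIm isCompact_Icc isCompact_Icc).inter_right
    apply IsClosed.union
    · exact isClosed_le continuous_const (Complex.continuous_re.add continuous_const)
    · exact isClosed_le continuous_const Complex.continuous_im.abs
  obtain ⟨C₂, hC₂⟩ := hcpt.exists_bound_of_continuousOn (f := gammaFactor m) (by
    rintro w ⟨-, hw⟩
    refine (differentiableAt_gammaFactor fun α hα => ?_).continuousAt.continuousWithinAt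
    have hre := congrArg Complex.re hα
    have him := congrArg Complex.im hα
    have e : ((m.natAbs : ℂ) / 2) = (((m.natAbs : ℝ) / 2 : ℝ) : ℂ) := by push_cast; ring
    rw [e] at hre him
    simp only [Complex.add_re, Complex.ofReal_re, Complex.neg_re, Complex.natCast_re, Complex.add_im,
      Complex.ofReal_im, Complex.neg_im, Complex.natCast_im, add_zero, neg_zero] at hre him
    have hα0 : (0 : ℝ) ≤ α := α.cast_nonneg
    rcases hw with hw | hw
    · linarith
    · rw [him, abs_zero] at hw; linarith)
  set E : ℝ := (2 : ℝ) ^ (2 * D + 1) with hE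
  have hE0 : 0 < E := by positivity
  refine ⟨|C₂| * E + (2 * Real.pi) ^ (1 + 2 * D) * C₁ * E, by positivity, fun w hw hw2 => ?_⟩
  obtain ⟨hw3, hw4⟩ := abs_le.1 hw
  have hpw : 0 < (1 + |w.im|) ^ (2 * w.re - 1) := by positivity
  -- For `1 ≤ r ≤ 2` the power `r ^ (2 Re w - 1)` is bounded below by `1 / E`.
  have hEle : ∀ r : ℝ, 1 ≤ r → r ≤ 2 → 1 ≤ E * r ^ (2 * w.re - 1) := by
    intro r hr1 hr2
    have : r ^ (-(2 * w.re - 1)) ≤ E := by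
      calc r ^ (-(2 * w.re - 1)) ≤ r ^ (2 * D + 1) :=
            Real.rpow_le_rpow_of_exponent_le hr1 (by linarith)
        _ ≤ E := Real.rpow_le_rpow (by linarith) hr2 (by linarith)
    rw [Real.rpow_neg (by linarith), inv_le_iff_one_le_mul₀ (by positivity)] at this
    exact this
  rcases le_total |w.im| 1 with hv | hv
  · have h3 := hC₂ w ⟨by rw [Complex.mem_reProdIm]; exact ⟨abs_le.1 hw, abs_le.1 hv⟩, hw2⟩
    have h4 := hEle (1 + |w.im|) (by linarith [abs_nonneg w.im]) (by linarith)
    calc ‖gammaFactor m w‖ ≤ |C₂| * 1 := by rw [mul_one]; exact h3.trans (le_abs_self _)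
      _ ≤ |C₂| * (E * (1 + |w.im|) ^ (2 * w.re - 1)) := by gcongr
      _ ≤ _ := by
        have : 0 ≤ (2 * Real.pi) ^ (1 + 2 * D) * C₁ * E * (1 + |w.im|) ^ (2 * w.re - 1) := by
          positivity
        linarith
  · have h3 := h₁ w hw hv
    rw [norm_gammaFactor]
    push_cast at h3
    have hv0 : 0 < |w.im| := by linarith
    have h4 : ‖Complex.Gamma (w + (m.natAbs : ℂ) / 2)‖ /
        ‖Complex.Gamma (1 - w + (m.natAbs : ℂ) / 2)‖ ≤ C₁ * |w.im| ^ (2 * w.re - 1) :=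
      div_le_of_le_mul₀ (norm_nonneg _) (by positivity) h3
    have h5 : |w.im| ^ (2 * w.re - 1) ≤ E * (1 + |w.im|) ^ (2 * w.re - 1) := by
      have h6 := hEle ((1 + |w.im|) / |w.im|) (by rw [le_div_iff₀ hv0]; linarith)
        (by rw [div_le_iff₀ hv0]; linarith)
      rw [Real.div_rpow (by positivity) hv0.le] at h6
      have h7 : 0 < |w.im| ^ (2 * w.re - 1) := by positivity
      calc |w.im| ^ (2 * w.re - 1) = |w.im| ^ (2 * w.re - 1) * 1 := by ring
        _ ≤ |w.im| ^ (2 * w.re - 1) *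
          (E * ((1 + |w.im|) ^ (2 * w.re - 1) / |w.im| ^ (2 * w.re - 1))) := by gcongr
        _ = _ := by field_simp
    calc _ ≤ (2 * Real.pi) ^ (1 + 2 * D) * (C₁ * (E * (1 + |w.im|) ^ (2 * w.re - 1))) := by
          refine mul_le_mul (two_pi_rpow_le hw) (h4.trans ?_) (by positivity) (by positivity)
          gcongr
      _ ≤ _ := by
        have : 0 ≤ |C₂| * E * (1 + |w.im|) ^ (2 * w.re - 1) := by positivity
        linarith

/-- Bound for a gamma factor of large weight to the left of `Re w = -3/2`. The constant does not depend
on `m`, and the decay is integrable in `Im w` and summable in `m`. -/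
theorem exists_norm_gammaFactor_le_of_large (D : ℝ) :
    ∃ C : ℝ, 0 < C ∧ ∀ (m : ℤ) (w : ℂ), |w.re| ≤ D → w.re ≤ -3 / 2 →
      D + 1 ≤ (m.natAbs : ℝ) / 2 →
      ‖gammaFactor m w‖ ≤ C * (((m.natAbs : ℝ) / 2 - D) ^ 2)⁻¹ * (1 + w.im ^ 2)⁻¹ := by
  obtain ⟨K, hK, hS⟩ := exists_norm_Gamma_le_mul_rpow
  refine ⟨(2 * Real.pi) ^ (1 + 2 * D) * K, by positivity, fun m w hw hw2 hm => ?_⟩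
  obtain ⟨hw3, hw4⟩ := abs_le.1 hw
  set a : ℝ := (m.natAbs : ℝ) / 2 with ha
  have hac : ((m.natAbs : ℂ) / 2) = (a : ℂ) := by
    rw [ha, Complex.ofReal_div, Complex.ofReal_natCast, Complex.ofReal_ofNat]
  rw [norm_gammaFactor, hac]
  set z : ℂ := w + a with hz
  have hzre : a - D ≤ z.re := by simp [hz]; linarith
  have hzim : z.im = w.im := by simp [hz]
  have h1 := hS z (by linarith) (1 - 2 * w.re) (by linarith)
  have e : ‖Complex.Gamma (1 - w + a)‖ = ‖Complex.Gamma (z + ((1 - 2 * w.re : ℝ) : ℂ))‖ := by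
    rw [← norm_Gamma_conj]
    congr 2
    apply Complex.ext
    · simp [hz]; ring
    · simp [hz]
  rw [e]
  have hz1 : 1 ≤ ‖z‖ := le_trans (by linarith) (Complex.re_le_norm z)
  have h2 : ‖z‖ ^ (-(1 - 2 * w.re)) ≤ ((a - D) ^ 2)⁻¹ * (1 + w.im ^ 2)⁻¹ := by
    calc ‖z‖ ^ (-(1 - 2 * w.re)) ≤ ‖z‖ ^ (-((4 : ℕ) : ℝ)) :=
          Real.rpow_le_rpow_of_exponent_le hz1 (by push_cast; linarith)
      _ = (‖z‖ ^ 2)⁻¹ * (‖z‖ ^ 2)⁻¹ := by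
          rw [Real.rpow_neg (norm_nonneg _), Real.rpow_natCast, ← mul_inv]; ring
      _ ≤ _ := by
          have h3 : ‖z‖ ^ 2 = z.re ^ 2 + w.im ^ 2 := by
            rw [Complex.sq_norm, Complex.normSq_apply, hzim]; ring
          have h4 : (a - D) ^ 2 ≤ z.re ^ 2 := by
            apply pow_le_pow_left₀ (by linarith) hzre
          have h5 : 0 < (a - D) ^ 2 := by apply pow_pos; linarith
          have h6 : 1 ≤ z.re ^ 2 := by nlinarith
          rw [h3]
          gcongr
          nlinarith [sq_nonneg w.im]
  calc _ ≤ (2 * Real.pi) ^ (1 + 2 * D) * (K * (((a - D) ^ 2)⁻¹ * (1 + w.im ^ 2)⁻¹)) := by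
        refine mul_le_mul (two_pi_rpow_le hw) ?_ (by positivity) (by positivity)
        refine div_le_of_le_mul₀ (norm_nonneg _) (by positivity) (h1.trans ?_)
        gcongr
    _ = _ := by ring

/-! ### The Mellin-Barnes integrand -/

theorem one_add_abs_sub_rpow_le {R τ : ℝ} (hτ : |τ| ≤ R) (t e : ℝ) :
    (1 + |t - τ|) ^ e ≤ (1 + R) ^ |e| * (1 + |t|) ^ e := by
  have hR : 0 ≤ R := (abs_nonneg _).trans hτ
  have ht := abs_nonneg t
  have ht' := abs_nonneg (t - τ)
  rcases le_total 0 e with he | he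
  · rw [abs_of_nonneg he, ← Real.mul_rpow (by positivity) (by positivity)]
    refine Real.rpow_le_rpow (by positivity) ?_ he
    have := abs_sub t τ
    nlinarith
  · rw [abs_of_nonpos he, Real.rpow_neg (by positivity), ← div_eq_inv_mul, le_div_iff₀ (by positivity),
      ← Real.mul_rpow (by positivity) (by positivity)]
    refine Real.rpow_le_rpow_of_nonpos (by positivity) ?_ he
    have : |t| ≤ |t - τ| + |τ| := by simpa using abs_add_le (t - τ) τ
    nlinarith

theorem norm_ofReal_cpow_neg_two_mul_le {x : ℝ} (hx : 0 < x) {A : ℝ} {s : ℂ} (hs : |s.re| ≤ A) :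
    ‖(x : ℂ) ^ (-2 * s)‖ ≤ Real.exp (2 * A * |Real.log x|) := by
  rw [Complex.norm_cpow_eq_rpow_re_of_pos hx, Real.rpow_def_of_pos hx]
  apply Real.exp_le_exp.2
  have : (-2 * s).re = -2 * s.re := by simp
  rw [this]
  calc Real.log x * (-2 * s.re) ≤ |Real.log x * (-2 * s.re)| := le_abs_self _
    _ = 2 * |s.re| * |Real.log x| := by rw [abs_mul, abs_mul]; norm_num; ring
    _ ≤ _ := by gcongr

/-- Bound for the Mellin-Barnes integrand in a vertical strip, away from the poles, uniformly for
bounded `μ`. -/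
theorem exists_norm_mellinIntegrand_le {n : ℕ} (m : Fin n → ℤ) {x : ℝ} (hx : 0 < x) {R A δ : ℝ}
    (hR : 0 ≤ R) (hA : 0 ≤ A) (hδ : 0 < δ) :
    ∃ C : ℝ, 0 < C ∧ ∀ μ : Fin n → ℂ, (∀ l, ‖μ l‖ ≤ R) → ∀ s : ℂ, |s.re| ≤ A →
      (∀ l, δ ≤ s.re - (μ l).re + ((m l).natAbs : ℝ) / 2 ∨ δ ≤ |s.im - (μ l).im|) →
      ‖mellinIntegrand μ m x s‖ ≤ C * (1 + |s.im|) ^ (2 * n * s.re - 2 * (∑ l, μ l).re - n) := by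
  have hC : ∀ l, ∃ C : ℝ, 0 < C ∧ ∀ w : ℂ, |w.re| ≤ A + R →
      (δ ≤ w.re + ((m l).natAbs : ℝ) / 2 ∨ δ ≤ |w.im|) →
      ‖gammaFactor (m l) w‖ ≤ C * (1 + |w.im|) ^ (2 * w.re - 1) := fun l =>
    exists_norm_gammaFactor_le (m l) (A + R) δ (by positivity) hδ
  choose C hC0 hC using hC
  have hP : 0 < ∏ l, (C l * (1 + R) ^ (2 * (A + R) + 1)) :=
    Finset.prod_pos fun l _ => mul_pos (hC0 l) (Real.rpow_pos_of_pos (by positivity) _)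
  refine ⟨(∏ l, (C l * (1 + R) ^ (2 * (A + R) + 1))) * Real.exp (2 * A * |Real.log x|),
    mul_pos hP (Real.exp_pos _), fun μ hμ s hs hgood => ?_⟩
  have hfac : ∀ l, ‖gammaFactor (m l) (s - μ l)‖ ≤
      C l * (1 + R) ^ (2 * (A + R) + 1) * (1 + |s.im|) ^ (2 * (s.re - (μ l).re) - 1) := by
    intro l
    have hre : |(s - μ l).re| ≤ A + R := by
      rw [Complex.sub_re]
      exact (abs_sub _ _).trans (add_le_add hs ((Complex.abs_re_le_norm _).trans (hμ l)))
    have h1 := hC l (s - μ l) hre (by simpa using hgood l)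
    rw [Complex.sub_im, Complex.sub_re] at h1
    refine h1.trans ?_
    rw [mul_assoc]
    gcongr
    · exact (hC0 l).le
    refine (one_add_abs_sub_rpow_le ((Complex.abs_im_le_norm _).trans (hμ l)) _ _).trans ?_
    gcongr
    · linarith
    · rw [Complex.sub_re] at hre
      refine (abs_sub _ _).trans ?_
      rw [abs_mul, abs_one, abs_two]
      linarith
  have hsum : ∑ l, (2 * (s.re - (μ l).re) - 1) = 2 * n * s.re - 2 * (∑ l, μ l).re - n := by
    simp only [Finset.sum_sub_distrib, ← Finset.mul_sum, Complex.re_sum]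
    simp
    ring
  rw [← hsum, Real.rpow_sum_of_pos (by positivity), mellinIntegrand, gammaProd, norm_mul, norm_prod]
  calc _ ≤ (∏ l, (C l * (1 + R) ^ (2 * (A + R) + 1) *
          (1 + |s.im|) ^ (2 * (s.re - (μ l).re) - 1))) * Real.exp (2 * A * |Real.log x|) := by
        refine mul_le_mul ?_ (norm_ofReal_cpow_neg_two_mul_le hx hs) (norm_nonneg _) ?_
        · exact Finset.prod_le_prod (fun _ _ => norm_nonneg _) fun l _ => hfac l
        · exact Finset.prod_nonneg fun l _ => (norm_nonneg _).trans (hfac l)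
    _ = _ := by rw [Finset.prod_mul_distrib]; ring

theorem differentiableAt_mellinIntegrand {n : ℕ} {μ : Fin n → ℂ} {m : Fin n → ℤ} {x : ℝ}
    (hx : 0 < x) {s : ℂ} (h : ∀ l, ∀ α : ℕ, s ≠ μ l - ((m l).natAbs : ℂ) / 2 - α) :
    DifferentiableAt ℂ (mellinIntegrand μ m x) s := by
  unfold mellinIntegrand gammaProd
  refine DifferentiableAt.mul ?_ (DifferentiableAt.const_cpow (by fun_prop)
    (Or.inl (by exact_mod_cast hx.ne')))
  refine DifferentiableAt.fun_finsetProd fun l _ => ?_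
  refine DifferentiableAt.comp (g := gammaFactor (m l)) (f := fun s : ℂ => s - μ l) s
    (differentiableAt_gammaFactor fun α hα => h l α ?_) (by fun_prop)
  linear_combination hα

theorem differentiableAt_mellinIntegrand_of_right {n : ℕ} {μ : Fin n → ℂ} {m : Fin n → ℤ} {x : ℝ}
    (hx : 0 < x) {s : ℂ} (h : ∀ l, (μ l).re - |(m l : ℝ)| / 2 < s.re ∨ |(μ l).im| < |s.im|) :
    DifferentiableAt ℂ (mellinIntegrand μ m x) s := by
  refine differentiableAt_mellinIntegrand hx fun l α hs => ?_
  have e : ((m l).natAbs : ℂ) / 2 = ((|(m l : ℝ)| / 2 : ℝ) : ℂ) := by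
    rw [Complex.ofReal_div, Complex.ofReal_ofNat, ← Int.cast_abs, ← Nat.cast_natAbs,
      Complex.ofReal_natCast]
  rw [e] at hs
  have hre := congrArg Complex.re hs
  have him := congrArg Complex.im hs
  simp only [Complex.sub_re, Complex.ofReal_re, Complex.natCast_re, Complex.sub_im,
    Complex.ofReal_im, Complex.natCast_im, sub_zero] at hre him
  have hα0 : (0 : ℝ) ≤ α := α.cast_nonneg
  rcases h l with h | h
  · linarith
  · rw [him] at h; exact lt_irrefl _ h

/-! ### Mellin-Barnes contours -/

open MeasureTheory in
/-- The integral along the polygonal contour with parameters `σ`, `ρ`, `T`, for arbitrary values of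
the parameters. -/
noncomputable def contourIntegral (σ ρ T : ℝ) (f : ℂ → ℂ) : ℂ :=
  (∫ t in Set.Iic (-T), f (σ + t * Complex.I) * Complex.I) +
    (∫ r in σ..ρ, f (r - T * Complex.I)) +
    (∫ t in (-T)..T, f (ρ + t * Complex.I) * Complex.I) +
    (∫ r in ρ..σ, f (r + T * Complex.I)) +
    ∫ t in Set.Ioi T, f (σ + t * Complex.I) * Complex.I

section Contour

open MeasureTheory Filter

variable {f : ℂ → ℂ} {σ σ' ρ ρ' T T' : ℝ}

theorem continuousOn_vertical (a : ℝ) {s : Set ℝ}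
    (h : ∀ t ∈ s, DifferentiableAt ℂ f (a + t * Complex.I)) :
    ContinuousOn (fun t : ℝ => f (a + t * Complex.I)) s := fun t ht =>
  (ContinuousAt.comp (f := fun t : ℝ => (a : ℂ) + t * Complex.I) (h t ht).continuousAt
    (by fun_prop)).continuousWithinAt

theorem continuousOn_horizontal (c : ℂ) {s : Set ℝ}
    (h : ∀ r ∈ s, DifferentiableAt ℂ f (r + c)) :
    ContinuousOn (fun r : ℝ => f (r + c)) s := fun r hr =>
  (ContinuousAt.comp (f := fun r : ℝ => (r : ℂ) + c) (h r hr).continuousAt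
    (by fun_prop)).continuousWithinAt

theorem integrable_one_add_abs_rpow (C : ℝ) {e : ℝ} (he : e < -1) :
    Integrable fun t : ℝ => C * (1 + |t|) ^ e := by
  have := integrable_one_add_norm (E := ℝ) (μ := volume) (r := -e) (by simpa using by linarith)
  simpa using this.const_mul C

/-- `f` is holomorphic for `|Im s| ≥ T` and decays integrably there in the strip between the
vertical lines through `σ` and `σ'`. -/
structure DecaysOnTails (f : ℂ → ℂ) (σ σ' T : ℝ) : Prop where
  diff : ∀ s : ℂ, T ≤ |s.im| → DifferentiableAt ℂ f s
  bound : ∃ C e : ℝ, e < -1 ∧ ∀ s : ℂ, s.re ∈ Set.uIcc σ σ' → T ≤ |s.im| →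
    ‖f s‖ ≤ C * (1 + |s.im|) ^ e

theorem DecaysOnTails.symm (h : DecaysOnTails f σ σ' T) : DecaysOnTails f σ' σ T :=
  ⟨h.diff, by rw [Set.uIcc_comm]; exact h.bound⟩

theorem DecaysOnTails.comp_neg (h : DecaysOnTails f σ σ' T) :
    DecaysOnTails (fun s => f (-s)) (-σ) (-σ') T := by
  refine ⟨fun s hs => ?_, ?_⟩
  · exact DifferentiableAt.comp (f := fun s : ℂ => -s) s (h.diff _ (by simpa using hs)) (by fun_prop)
  · obtain ⟨C, e, he, hb⟩ := h.bound
    refine ⟨C, e, he, fun s hs hT => ?_⟩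
    have := hb (-s) (by
      rw [Set.mem_uIcc] at hs ⊢
      simp only [Complex.neg_re]
      rcases hs with hs | hs
      · right; constructor <;> linarith [hs.1, hs.2]
      · left; constructor <;> linarith [hs.1, hs.2]) (by simpa using hT)
    simpa using this

theorem DecaysOnTails.integrableOn_Ioi (h : DecaysOnTails f σ σ' T) :
    IntegrableOn (fun t : ℝ => f (σ + t * Complex.I)) (Set.Ioi T) := by
  obtain ⟨C, e, he, hb⟩ := h.bound
  refine Integrable.mono' (integrable_one_add_abs_rpow C he).integrableOn
    (ContinuousOn.aestronglyMeasurable (continuousOn_vertical σ fun t ht => h.diff _ ?_)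
      measurableSet_Ioi) ?_
  · simpa using (le_of_lt ht).trans (le_abs_self t)
  · filter_upwards [ae_restrict_mem measurableSet_Ioi] with t ht
    have := hb (σ + t * Complex.I) (by simp) (by simpa using (le_of_lt ht).trans (le_abs_self t))
    simpa using this

theorem DecaysOnTails.integrableOn_Iic (h : DecaysOnTails f σ σ' T) :
    IntegrableOn (fun t : ℝ => f (σ + t * Complex.I)) (Set.Iic (-T)) := by
  have h1 := (h.comp_neg.integrableOn_Ioi).comp_neg
  rw [Set.neg_Ioi, ← integrableOn_Iic_iff_integrableOn_Iio] at h1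
  refine h1.congr_fun (fun t _ => ?_) measurableSet_Iic
  simp only
  congr 1
  push_cast
  ring

/-- Cauchy's theorem for the upper half strip between two vertical lines. -/
theorem DecaysOnTails.integral_Ioi_eq (h : DecaysOnTails f σ σ' T) :
    (∫ t in Set.Ioi T, f (σ + t * Complex.I) * Complex.I) =
      (∫ r in σ..σ', f (r + T * Complex.I)) +
        ∫ t in Set.Ioi T, f (σ' + t * Complex.I) * Complex.I := by
  obtain ⟨C, e, he, hb⟩ := h.bound
  have hrect : ∀ R : ℝ, T ≤ R → (∫ r in σ..σ', f (r + T * Complex.I)) -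
      (∫ r in σ..σ', f (r + R * Complex.I)) +
      Complex.I • (∫ t in T..R, f (σ' + t * Complex.I)) -
      Complex.I • (∫ t in T..R, f (σ + t * Complex.I)) = 0 := by
    intro R hR
    have := Complex.integral_boundary_rect_eq_zero_of_differentiableOn f
      (σ + T * Complex.I) (σ' + R * Complex.I) (by
        intro s hs
        rw [Complex.mem_reProdIm] at hs
        have h2 := hs.2
        simp only [Complex.add_im, Complex.ofReal_im, Complex.mul_im, Complex.ofReal_re,
          Complex.I_im, Complex.I_re, mul_one, mul_zero, zero_add, add_zero,
          Set.uIcc_of_le hR] at h2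
        exact (h.diff s (h2.1.trans (le_abs_self _))).differentiableWithinAt)
    simpa using this
  have l1 := intervalIntegral_tendsto_integral_Ioi T h.integrableOn_Ioi tendsto_id
  have l2 := intervalIntegral_tendsto_integral_Ioi T h.symm.integrableOn_Ioi tendsto_id
  have l3 : Tendsto (fun R : ℝ => ∫ r in σ..σ', f (r + R * Complex.I)) atTop (𝓝 0) := by
    have hlim : Tendsto (fun R : ℝ => C * (1 + |R|) ^ e * |σ' - σ|) atTop (𝓝 0) := by
      have h1 : Tendsto (fun R : ℝ => 1 + |R|) atTop atTop :=
        tendsto_atTop_add_const_left _ _ tendsto_abs_atTop_atTop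
      have h2 := (tendsto_rpow_neg_atTop (y := -e) (by linarith)).comp h1
      have h3 := (h2.const_mul C).mul_const |σ' - σ|
      simpa [Function.comp_def] using h3
    refine squeeze_zero_norm' ?_ hlim
    filter_upwards [eventually_ge_atTop T] with R hR
    refine intervalIntegral.norm_integral_le_of_norm_le_const fun r hr => ?_
    have := hb (r + R * Complex.I) (by simpa using Set.uIoc_subset_uIcc hr)
      (by simpa using hR.trans (le_abs_self R))
    simpa using this
  have l4 : Tendsto (fun R : ℝ => (∫ r in σ..σ', f (r + T * Complex.I)) -
      (∫ r in σ..σ', f (r + R * Complex.I)) +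
      Complex.I • (∫ t in T..R, f (σ' + t * Complex.I)) -
      Complex.I • (∫ t in T..R, f (σ + t * Complex.I))) atTop
      (𝓝 ((∫ r in σ..σ', f (r + T * Complex.I)) - 0 +
        Complex.I • (∫ t in Set.Ioi T, f (σ' + t * Complex.I)) -
        Complex.I • (∫ t in Set.Ioi T, f (σ + t * Complex.I)))) :=
    (((tendsto_const_nhds.sub l3).add (l2.const_smul Complex.I)).sub (l1.const_smul Complex.I))
  have l5 := tendsto_nhds_unique (l4.congr' (by
    filter_upwards [eventually_ge_atTop T] with R hR using hrect R hR)) tendsto_const_nhds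
  rw [integral_mul_const, integral_mul_const]
  simp only [smul_eq_mul, sub_zero] at l5
  linear_combination -l5

/-- Cauchy's theorem for the lower half strip between two vertical lines. -/
theorem DecaysOnTails.integral_Iic_eq (h : DecaysOnTails f σ σ' T) :
    (∫ t in Set.Iic (-T), f (σ + t * Complex.I) * Complex.I) =
      (∫ r in σ'..σ, f (r - T * Complex.I)) +
        ∫ t in Set.Iic (-T), f (σ' + t * Complex.I) * Complex.I := by
  have key := h.comp_neg.integral_Ioi_eq
  have e : ∀ a : ℝ, (∫ t in Set.Ioi T, f (-(((-a : ℝ) : ℂ) + t * Complex.I)) * Complex.I) =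
      ∫ t in Set.Iic (-T), f (a + t * Complex.I) * Complex.I := by
    intro a
    rw [← integral_comp_neg_Ioi T (fun t : ℝ => f (a + t * Complex.I) * Complex.I)]
    congr 1
    ext t
    congr 2
    push_cast
    ring
  have e2 : (∫ r in (-σ)..(-σ'), f (-((r : ℂ) + T * Complex.I))) =
      ∫ r in σ'..σ, f (r - T * Complex.I) := by
    have := intervalIntegral.integral_comp_neg (a := -σ) (b := -σ')
      (fun r : ℝ => f (r - T * Complex.I))
    rw [neg_neg, neg_neg] at this
    rw [← this]
    congr 1
    ext r
    congr 1
    push_cast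
    ring
  simp only [e, e2] at key
  exact key

theorem contourIntegral_eq_of_line (hT : 0 ≤ T) (h : DecaysOnTails f σ σ' T) :
    contourIntegral σ ρ T f = contourIntegral σ' ρ T f := by
  have hh : ∀ (c : ℝ), |c| = T → ∀ a b : ℝ,
      IntervalIntegrable (fun r : ℝ => f (r + c * Complex.I)) volume a b := fun c hc a b =>
    (continuousOn_horizontal _ fun r _ => h.diff _ (by simp [hc])).intervalIntegrable
  have hp := hh T (abs_of_nonneg hT)
  have hm := hh (-T) (by rw [abs_neg, abs_of_nonneg hT])
  simp only [Complex.ofReal_neg, neg_mul, ← sub_eq_add_neg] at hm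
  have i1 := intervalIntegral.integral_add_adjacent_intervals (hm σ' σ) (hm σ ρ)
  have i2 := intervalIntegral.integral_add_adjacent_intervals (hp ρ σ) (hp σ σ')
  unfold contourIntegral
  rw [h.integral_Ioi_eq, h.integral_Iic_eq, ← i1, ← i2]
  ring

theorem contourIntegral_eq_of_bump (hT : 0 ≤ T)
    (h : ∀ s : ℂ, T ≤ |s.im| ∨ s.re ∈ Set.uIcc ρ ρ' → DifferentiableAt ℂ f s) :
    contourIntegral σ ρ T f = contourIntegral σ ρ' T f := by
  have hh : ∀ (c : ℝ), |c| = T → ∀ a b : ℝ,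
      IntervalIntegrable (fun r : ℝ => f (r + c * Complex.I)) volume a b := fun c hc a b =>
    (continuousOn_horizontal _ fun r _ => h _ (by simp [hc])).intervalIntegrable
  have hp := hh T (abs_of_nonneg hT)
  have hm := hh (-T) (by rw [abs_neg, abs_of_nonneg hT])
  simp only [Complex.ofReal_neg, neg_mul, ← sub_eq_add_neg] at hm
  have i1 := intervalIntegral.integral_add_adjacent_intervals (hm σ ρ) (hm ρ ρ')
  have i2 := intervalIntegral.integral_add_adjacent_intervals (hp ρ' ρ) (hp ρ σ)
  have i3 := intervalIntegral.integral_symm (μ := volume) (f := fun r : ℝ => f (r + T * Complex.I))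
    ρ ρ'
  have hrect := Complex.integral_boundary_rect_eq_zero_of_differentiableOn f
      (ρ - T * Complex.I) (ρ' + T * Complex.I) (by
        intro s hs
        rw [Complex.mem_reProdIm] at hs
        exact (h s (Or.inr (by simpa using hs.1))).differentiableWithinAt)
  simp at hrect
  simp only [← sub_eq_add_neg] at hrect
  unfold contourIntegral
  rw [← i1, ← i2, intervalIntegral.integral_mul_const, intervalIntegral.integral_mul_const, i3]
  linear_combination -hrect

theorem contourIntegral_eq_of_height (hTT : T ≤ T') (h : DecaysOnTails f σ σ T)
    (hρ : ∀ s : ℂ, s.re = ρ → DifferentiableAt ℂ f s) :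
    contourIntegral σ ρ T f = contourIntegral σ ρ T' f := by
  have hv : ∀ a b : ℝ, IntervalIntegrable (fun t : ℝ => f (ρ + t * Complex.I)) volume a b :=
    fun a b => (continuousOn_vertical ρ fun t _ => hρ _ (by simp)).intervalIntegrable
  have r1 := Complex.integral_boundary_rect_eq_zero_of_differentiableOn f
      (σ + T * Complex.I) (ρ + T' * Complex.I) (by
        intro s hs
        rw [Complex.mem_reProdIm] at hs
        have h2 : s.im ∈ Set.uIcc T T' := by simpa using hs.2
        rw [Set.uIcc_of_le hTT] at h2
        exact (h.diff s (h2.1.trans (le_abs_self _))).differentiableWithinAt)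
  have r2 := Complex.integral_boundary_rect_eq_zero_of_differentiableOn f
      (σ - T' * Complex.I) (ρ - T * Complex.I) (by
        intro s hs
        rw [Complex.mem_reProdIm] at hs
        have h2 : s.im ∈ Set.uIcc (-T') (-T) := by simpa using hs.2
        rw [Set.uIcc_of_le (by linarith)] at h2
        refine (h.diff s ?_).differentiableWithinAt
        rw [le_abs]
        right
        linarith [h2.2])
  simp at r1 r2
  simp only [← sub_eq_add_neg] at r2
  have i1 := intervalIntegral.integral_interval_add_Ioi (a := T) (b := T') h.integrableOn_Ioi
    (h.integrableOn_Ioi.mono_set (Set.Ioi_subset_Ioi hTT))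
  have i2 := intervalIntegral.integral_Iic_sub_Iic (a := -T') (b := -T)
    (h.integrableOn_Iic.mono_set (Set.Iic_subset_Iic.2 (by linarith))) h.integrableOn_Iic
  have i3 := intervalIntegral.integral_add_adjacent_intervals (hv (-T') (-T)) (hv (-T) T)
  have i4 := intervalIntegral.integral_add_adjacent_intervals (hv (-T') T) (hv T T')
  have i5 := intervalIntegral.integral_symm (μ := volume) (f := fun r : ℝ => f (r + T * Complex.I))
    σ ρ
  have i6 := intervalIntegral.integral_symm (μ := volume) (f := fun r : ℝ => f (r + T' * Complex.I))
    σ ρ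
  unfold contourIntegral
  rw [intervalIntegral.integral_mul_const, intervalIntegral.integral_mul_const, integral_mul_const,
    integral_mul_const, integral_mul_const, integral_mul_const, i5, i6, ← i4, ← i3, ← i1]
  linear_combination -r1 - r2 + Complex.I * i2

end Contour

section Kernel

variable {n : ℕ} {μ : Fin n → ℂ} {m : Fin n → ℤ} {x : ℝ}

theorem decaysOnTails_mellinIntegrand (hn : 1 ≤ n) (hx : 0 < x) {σ σ' T : ℝ}
    (hσ : σ < 1 / 2 + ((∑ l, μ l).re - 1 / 2) / n) (hσ' : σ' < 1 / 2 + ((∑ l, μ l).re - 1 / 2) / n)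
    (hT : ∀ l, |(μ l).im| < T) : DecaysOnTails (mellinIntegrand μ m x) σ σ' T := by
  refine ⟨fun s hs => differentiableAt_mellinIntegrand_of_right hx fun l =>
    Or.inr ((hT l).trans_le hs), ?_⟩
  have : Nonempty (Fin n) := ⟨⟨0, hn⟩⟩
  obtain ⟨l₀, hl₀⟩ := Finite.exists_max fun l => |(μ l).im|
  have hA : 0 ≤ max |σ| |σ'| := (abs_nonneg σ).trans (le_max_left _ _)
  obtain ⟨C, hC, hb⟩ := exists_norm_mellinIntegrand_le m hx (norm_nonneg μ) hA
    (sub_pos.2 (hT l₀))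
  have hn0 : (0 : ℝ) < n := by exact_mod_cast hn
  refine ⟨C, 2 * n * max σ σ' - 2 * (∑ l, μ l).re - n, ?_, fun s hs hsT => ?_⟩
  · have h1 : max σ σ' < 1 / 2 + ((∑ l, μ l).re - 1 / 2) / n := max_lt hσ hσ'
    have h2 := mul_lt_mul_of_pos_left h1 hn0
    have h3 : (n : ℝ) * (1 / 2 + ((∑ l, μ l).re - 1 / 2) / n) = n / 2 + ((∑ l, μ l).re - 1 / 2) := by
      field_simp
    linarith
  · have h1 : |s.re| ≤ max |σ| |σ'| := by
      rw [Set.mem_uIcc] at hs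
      rcases hs with hs | hs
      · exact abs_le_max_abs_abs hs.1 hs.2
      · rw [max_comm]; exact abs_le_max_abs_abs hs.1 hs.2
    have h2 : s.re ≤ max σ σ' := (Set.mem_uIcc.1 hs).elim (fun h => h.2.trans (le_max_right _ _))
      (fun h => h.2.trans (le_max_left _ _))
    refine (hb μ (norm_le_pi_norm μ) s h1 fun l => Or.inr ?_).trans ?_
    · have := abs_sub_abs_le_abs_sub s.im (μ l).im
      have := hl₀ l
      linarith
    · gcongr
      linarith [abs_nonneg s.im]

theorem BarnesContour.T_pos (hn : 1 ≤ n) (C : BarnesContour μ m) : 0 < C.T :=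
  (abs_nonneg _).trans_lt (C.im_lt ⟨0, hn⟩)

theorem BarnesContour.differentiableAt (C : BarnesContour μ m) (hx : 0 < x) {s : ℂ}
    (hs : C.T ≤ |s.im| ∨ C.ρ ≤ s.re) : DifferentiableAt ℂ (mellinIntegrand μ m x) s :=
  differentiableAt_mellinIntegrand_of_right hx fun l =>
    hs.elim (fun h => Or.inr ((C.im_lt l).trans_le h)) fun h => Or.inl ((C.re_lt l).trans_le h)

theorem BarnesContour.absConverges (hn : 1 ≤ n) (hx : 0 < x) (C : BarnesContour μ m) :
    C.AbsConverges (mellinIntegrand μ m x) := by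
  have h := decaysOnTails_mellinIntegrand (m := m) hn hx C.σ_lt C.σ_lt C.im_lt
  have hT := C.T_pos hn
  refine ⟨h.integrableOn_Iic, ?_, ?_, ?_, h.integrableOn_Ioi⟩
  · simp only [sub_eq_add_neg]
    exact (continuousOn_horizontal _ fun r _ => h.diff _
      (by simp [abs_of_pos hT])).intervalIntegrable
  · exact (continuousOn_vertical _ fun t _ =>
      C.differentiableAt hx (Or.inr (by simp))).intervalIntegrable
  · exact (continuousOn_horizontal _ fun r _ => h.diff _
      (by simp [abs_of_pos hT])).intervalIntegrable

theorem BarnesContour.integral_eq (C : BarnesContour μ m) (f : ℂ → ℂ) :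
    C.integral f = contourIntegral C.σ C.ρ C.T f := rfl

/-- The Mellin-Barnes integral does not depend on the admissible contour. -/
theorem BarnesContour.integral_eq_integral (hn : 1 ≤ n) (hx : 0 < x) (C C' : BarnesContour μ m) :
    C.integral (mellinIntegrand μ m x) = C'.integral (mellinIntegrand μ m x) := by
  have hT := C.T_pos hn
  have hT' := C'.T_pos hn
  have h1 := contourIntegral_eq_of_line (ρ := C.ρ) hT.le
    (decaysOnTails_mellinIntegrand (m := m) hn hx C.σ_lt C'.σ_lt C.im_lt)
  have h2 := contourIntegral_eq_of_bump (σ := C'.σ) (ρ := C.ρ) (ρ' := C'.ρ) hT.le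
    (f := mellinIntegrand μ m x) (by
      rintro s (hs | hs)
      · exact C.differentiableAt hx (Or.inl hs)
      · rcases Set.mem_uIcc.1 hs with hs | hs
        · exact C.differentiableAt hx (Or.inr hs.1)
        · exact C'.differentiableAt hx (Or.inr hs.1))
  have hd : ∀ s : ℂ, s.re = C'.ρ → DifferentiableAt ℂ (mellinIntegrand μ m x) s :=
    fun s hs => C'.differentiableAt hx (Or.inr hs.ge)
  have h3 := contourIntegral_eq_of_height (le_max_left C.T C'.T)
    (decaysOnTails_mellinIntegrand (m := m) hn hx C'.σ_lt C'.σ_lt C.im_lt) hd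
  have h4 := contourIntegral_eq_of_height (le_max_right C.T C'.T)
    (decaysOnTails_mellinIntegrand (m := m) hn hx C'.σ_lt C'.σ_lt C'.im_lt) hd
  rw [C.integral_eq, C'.integral_eq, h1, h2, h3, h4]

theorem radialBesselKernel_eq (hn : 1 ≤ n) (hx : 0 < x) (C C' : BarnesContour μ m) :
    radialBesselKernel C x = radialBesselKernel C' x := by
  rw [radialBesselKernel, radialBesselKernel, C.integral_eq_integral hn hx C']

end Kernel

/-! ### The residue theorem for simple poles in a rectangle -/

section Rectangle

open Filter

variable {a b c d : ℝ}

/-- The counterclockwise integral over the boundary of the rectangle `[a, b] × [c, d]`. -/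
noncomputable def rectIntegral (a b c d : ℝ) (f : ℂ → ℂ) : ℂ :=
  (∫ r in a..b, f (r + c * Complex.I)) - (∫ r in a..b, f (r + d * Complex.I)) +
    Complex.I * (∫ t in c..d, f (b + t * Complex.I)) -
    Complex.I * (∫ t in c..d, f (a + t * Complex.I))

/-- The boundary of the rectangle `[a, b] × [c, d]`. -/
def rectBoundary (a b c d : ℝ) : Set ℂ :=
  (Set.Icc a b ×ℂ Set.Icc c d) \ (Set.Ioo a b ×ℂ Set.Ioo c d)

theorem mem_rectBoundary_horizontal (hab : a ≤ b) (hcd : c ≤ d) {r : ℝ} (hr : r ∈ Set.uIcc a b)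
    {e : ℝ} (he : e = c ∨ e = d) : (r + e * Complex.I : ℂ) ∈ rectBoundary a b c d := by
  rw [Set.uIcc_of_le hab] at hr
  simp only [rectBoundary, Set.mem_sdiff, Complex.mem_reProdIm, Complex.add_re, Complex.ofReal_re,
    Complex.mul_re, Complex.I_re, mul_zero, Complex.ofReal_im, Complex.I_im, mul_one, sub_self,
    add_zero, Complex.add_im, Complex.mul_im, zero_add]
  refine ⟨⟨hr, ?_⟩, fun h => ?_⟩
  · rcases he with rfl | rfl <;> simp [hcd]
  · rcases he with rfl | rfl <;> simp at h

theorem mem_rectBoundary_vertical (hab : a ≤ b) (hcd : c ≤ d) {t : ℝ} (ht : t ∈ Set.uIcc c d)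
    {e : ℝ} (he : e = a ∨ e = b) : (e + t * Complex.I : ℂ) ∈ rectBoundary a b c d := by
  rw [Set.uIcc_of_le hcd] at ht
  simp only [rectBoundary, Set.mem_sdiff, Complex.mem_reProdIm, Complex.add_re, Complex.ofReal_re,
    Complex.mul_re, Complex.I_re, mul_zero, Complex.ofReal_im, Complex.I_im, mul_one, sub_self,
    add_zero, Complex.add_im, Complex.mul_im, zero_add]
  refine ⟨⟨?_, ht⟩, fun h => ?_⟩
  · rcases he with rfl | rfl <;> simp [hab]
  · rcases he with rfl | rfl <;> simp at h

theorem rectIntegral_congr (hab : a ≤ b) (hcd : c ≤ d) {f g : ℂ → ℂ}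
    (h : Set.EqOn f g (rectBoundary a b c d)) : rectIntegral a b c d f = rectIntegral a b c d g := by
  unfold rectIntegral
  rw [intervalIntegral.integral_congr fun r hr =>
      h (mem_rectBoundary_horizontal hab hcd hr (Or.inl rfl)),
    intervalIntegral.integral_congr fun r hr =>
      h (mem_rectBoundary_horizontal hab hcd hr (Or.inr rfl)),
    intervalIntegral.integral_congr fun t ht =>
      h (mem_rectBoundary_vertical hab hcd ht (Or.inl rfl)),
    intervalIntegral.integral_congr fun t ht =>
      h (mem_rectBoundary_vertical hab hcd ht (Or.inr rfl))]

theorem intervalIntegrable_horizontal_of_rectBoundary (hab : a ≤ b) (hcd : c ≤ d) {f : ℂ → ℂ}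
    (hf : ContinuousOn f (rectBoundary a b c d)) {e : ℝ} (he : e = c ∨ e = d) :
    IntervalIntegrable (fun r : ℝ => f (r + e * Complex.I)) MeasureTheory.volume a b :=
  ContinuousOn.intervalIntegrable (hf.comp (by fun_prop) fun _ hr =>
    mem_rectBoundary_horizontal hab hcd hr he)

theorem intervalIntegrable_vertical_of_rectBoundary (hab : a ≤ b) (hcd : c ≤ d) {f : ℂ → ℂ}
    (hf : ContinuousOn f (rectBoundary a b c d)) {e : ℝ} (he : e = a ∨ e = b) :
    IntervalIntegrable (fun t : ℝ => f (e + t * Complex.I)) MeasureTheory.volume c d :=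
  ContinuousOn.intervalIntegrable (hf.comp (by fun_prop) fun _ ht =>
    mem_rectBoundary_vertical hab hcd ht he)

theorem rectIntegral_add (hab : a ≤ b) (hcd : c ≤ d) {f g : ℂ → ℂ}
    (hf : ContinuousOn f (rectBoundary a b c d)) (hg : ContinuousOn g (rectBoundary a b c d)) :
    rectIntegral a b c d (fun s => f s + g s) =
      rectIntegral a b c d f + rectIntegral a b c d g := by
  have H := @intervalIntegrable_horizontal_of_rectBoundary a b c d hab hcd
  have V := @intervalIntegrable_vertical_of_rectBoundary a b c d hab hcd
  unfold rectIntegral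
  rw [intervalIntegral.integral_add (H hf (Or.inl rfl)) (H hg (Or.inl rfl)),
    intervalIntegral.integral_add (H hf (Or.inr rfl)) (H hg (Or.inr rfl)),
    intervalIntegral.integral_add (V hf (Or.inl rfl)) (V hg (Or.inl rfl)),
    intervalIntegral.integral_add (V hf (Or.inr rfl)) (V hg (Or.inr rfl))]
  ring

theorem rectIntegral_const_mul (k : ℂ) (f : ℂ → ℂ) :
    rectIntegral a b c d (fun s => k * f s) = k * rectIntegral a b c d f := by
  unfold rectIntegral
  simp only [intervalIntegral.integral_const_mul]
  ring

theorem rectIntegral_eq_zero (hab : a ≤ b) (hcd : c ≤ d) {f : ℂ → ℂ}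
    (hf : ∀ s ∈ Set.Icc a b ×ℂ Set.Icc c d, DifferentiableAt ℂ f s) :
    rectIntegral a b c d f = 0 := by
  have := Complex.integral_boundary_rect_eq_zero_of_differentiableOn f
    (a + c * Complex.I) (b + d * Complex.I) (by
      intro s hs
      refine (hf s ?_).differentiableWithinAt
      simpa [Complex.mem_reProdIm, Set.uIcc_of_le hab, Set.uIcc_of_le hcd] using hs)
  simpa [rectIntegral] using this

theorem log_neg_of_im_pos {z : ℂ} (h : 0 < z.im) :
    Complex.log (-z) = Complex.log z - Real.pi * Complex.I := by
  rw [Complex.log, Complex.log, norm_neg, Complex.arg_neg_eq_arg_sub_pi_of_im_pos h]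
  push_cast
  ring

/-- The winding number of the boundary of a rectangle around an interior point is `1`. -/
theorem rectIntegral_inv_sub {p : ℂ} (hp : p ∈ Set.Ioo a b ×ℂ Set.Ioo c d) :
    rectIntegral a b c d (fun s => (s - p)⁻¹) = 2 * Real.pi * Complex.I := by
  obtain ⟨⟨ha, hb⟩, hc, hd⟩ := Complex.mem_reProdIm.1 hp
  have horiz : ∀ e : ℝ, e - p.im ≠ 0 → (∫ r in a..b, ((r + e * Complex.I : ℂ) - p)⁻¹) =
      Complex.log (b + e * Complex.I - p) - Complex.log (a + e * Complex.I - p) := by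
    intro e he
    have hsl : ∀ r : ℝ, (r + e * Complex.I - p : ℂ) ∈ Complex.slitPlane := fun r =>
      Or.inr (by simpa using he)
    refine intervalIntegral.integral_eq_sub_of_hasDerivAt
      (f := fun r : ℝ => Complex.log (r + e * Complex.I - p)) (fun r _ => ?_) ?_
    · have h1 : HasDerivAt (fun r : ℝ => (r + e * Complex.I - p : ℂ)) 1 r :=
        ((Complex.ofRealCLM.hasDerivAt (x := r)).add_const _).sub_const _
      simpa using h1.clog_real (hsl r)
    · refine ContinuousOn.intervalIntegrable (ContinuousOn.inv₀ (by fun_prop) fun r _ => ?_)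
      exact Complex.slitPlane_ne_zero (hsl r)
  have hder : ∀ e t : ℝ, HasDerivAt (fun t : ℝ => (e + t * Complex.I - p : ℂ)) Complex.I t := by
    intro e t
    have := (((Complex.ofRealCLM.hasDerivAt (x := t)).mul_const Complex.I).const_add (e : ℂ)).sub_const
      p
    simpa using this
  have right : Complex.I * (∫ t in c..d, ((b + t * Complex.I : ℂ) - p)⁻¹) =
      Complex.log (b + d * Complex.I - p) - Complex.log (b + c * Complex.I - p) := by
    have hsl : ∀ t : ℝ, (b + t * Complex.I - p : ℂ) ∈ Complex.slitPlane := fun t =>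
      Or.inl (by simpa using hb)
    rw [← intervalIntegral.integral_const_mul]
    refine intervalIntegral.integral_eq_sub_of_hasDerivAt
      (f := fun t : ℝ => Complex.log (b + t * Complex.I - p)) (fun t _ => ?_) ?_
    · simpa [div_eq_mul_inv] using (hder b t).clog_real (hsl t)
    · refine ContinuousOn.intervalIntegrable (ContinuousOn.mul continuousOn_const
        (ContinuousOn.inv₀ (by fun_prop) fun t _ => ?_))
      exact Complex.slitPlane_ne_zero (hsl t)
  -- The left side crosses the branch cut of `log (s - p)` but not that of `log (p - s)`.
  have left : Complex.I * (∫ t in c..d, ((a + t * Complex.I : ℂ) - p)⁻¹) =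
      Complex.log (-(a + d * Complex.I - p)) - Complex.log (-(a + c * Complex.I - p)) := by
    have hsl : ∀ t : ℝ, (-(a + t * Complex.I - p) : ℂ) ∈ Complex.slitPlane := fun t =>
      Or.inl (by simpa using ha)
    have hne : ∀ t : ℝ, (a + t * Complex.I - p : ℂ) ≠ 0 := fun t =>
      neg_ne_zero.1 (Complex.slitPlane_ne_zero (hsl t))
    rw [← intervalIntegral.integral_const_mul]
    refine intervalIntegral.integral_eq_sub_of_hasDerivAt
      (f := fun t : ℝ => Complex.log (-(a + t * Complex.I - p))) (fun t _ => ?_) ?_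
    · have h1 := (hder a t).fun_neg.clog_real (hsl t)
      rwa [neg_div_neg_eq, div_eq_mul_inv] at h1
    · exact ContinuousOn.intervalIntegrable (ContinuousOn.mul continuousOn_const
        (ContinuousOn.inv₀ (by fun_prop) fun t _ => hne t))
  have lT := log_neg_of_im_pos (z := a + d * Complex.I - p) (by simpa using hd)
  have lB := log_neg_of_im_pos (z := -(a + c * Complex.I - p)) (by simpa using hc)
  rw [neg_neg] at lB
  rw [rectIntegral, horiz c (by linarith), horiz d (by linarith), right, left, lT]
  linear_combination -lB

/-- The residue theorem for a rectangle and finitely many simple poles in its interior. -/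
theorem rectIntegral_eq_sum_residues (hab : a ≤ b) (hcd : c ≤ d) (S : Finset ℂ) :
    ∀ (f : ℂ → ℂ) (res : ℂ → ℂ), (∀ p ∈ S, p ∈ Set.Ioo a b ×ℂ Set.Ioo c d) →
      (∀ s ∈ Set.Icc a b ×ℂ Set.Icc c d, s ∉ S → DifferentiableAt ℂ f s) →
      (∀ p ∈ S, Tendsto (fun s => (s - p) * f s) (𝓝[≠] p) (𝓝 (res p))) →
      rectIntegral a b c d f = 2 * Real.pi * Complex.I * ∑ p ∈ S, res p := by
  induction S using Finset.induction_on with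
  | empty =>
    intro f res _ hf _
    simp [rectIntegral_eq_zero hab hcd fun s hs => hf s hs (Finset.notMem_empty s)]
  | insert p S hpS ih =>
    intro f res hS hf hres
    have hp := hS p (Finset.mem_insert_self p S)
    have hpo : IsOpen (Set.Ioo a b ×ℂ Set.Ioo c d) := isOpen_Ioo.reProdIm isOpen_Ioo
    have hsub : Set.Ioo a b ×ℂ Set.Ioo c d ⊆ Set.Icc a b ×ℂ Set.Icc c d := fun s hs =>
      ⟨Set.Ioo_subset_Icc_self hs.1, Set.Ioo_subset_Icc_self hs.2⟩
    -- Subtract the principal part at `p` and remove the singularity there.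
    set g : ℂ → ℂ := fun s => f s - res p * (s - p)⁻¹ with hg
    have hinv : ∀ s, s ≠ p → DifferentiableAt ℂ (fun s : ℂ => res p * (s - p)⁻¹) s := fun s hs =>
      ((differentiableAt_id.sub_const p).inv (sub_ne_zero.2 hs)).const_mul _
    have hgd : ∀ s ∈ Set.Icc a b ×ℂ Set.Icc c d, s ≠ p → s ∉ S → DifferentiableAt ℂ g s :=
      fun s hs hsp hsS => (hf s hs (by simp [hsp, hsS])).sub (hinv s hsp)
    set h : ℂ → ℂ := Function.update g p (limUnder (𝓝[≠] p) g) with hh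
    have hhg : ∀ s, s ≠ p → h =ᶠ[𝓝 s] g := fun s hs => by
      filter_upwards [isOpen_ne.mem_nhds hs] with y hy
      exact Function.update_of_ne hy _ _
    have hhd : ∀ s ∈ Set.Icc a b ×ℂ Set.Icc c d, s ∉ S → DifferentiableAt ℂ h s := by
      intro s hs hsS
      by_cases hsp : s = p
      · subst hsp
        have hN : (Set.Ioo a b ×ℂ Set.Ioo c d) \ (S : Set ℂ) ∈ 𝓝 s :=
          (hpo.sdiff S.finite_toSet.isClosed).mem_nhds ⟨hp, hsS⟩
        refine (Complex.differentiableOn_update_limUnder_of_isLittleO hN ?_ ?_).differentiableAt hN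
        · rintro y ⟨⟨hy1, hy2⟩, hy3⟩
          exact (hgd y (hsub hy1) hy3 hy2).differentiableWithinAt
        · rw [Asymptotics.isLittleO_iff_tendsto']
          · have h1 := (hres s (Finset.mem_insert_self s S)).sub_const (res s)
            have h2 : Tendsto (fun y : ℂ => (y - s) * g s) (𝓝[≠] s) (𝓝 0) := by
              have : Tendsto (fun y : ℂ => (y - s) * g s) (𝓝 s) (𝓝 ((s - s) * g s)) :=
                Continuous.tendsto (by fun_prop) s
              rw [sub_self, zero_mul] at this
              exact this.mono_left nhdsWithin_le_nhds
            have h3 := h1.sub h2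
            rw [sub_self, sub_zero] at h3
            refine h3.congr' ?_
            filter_upwards [self_mem_nhdsWithin] with y hy
            have : y - s ≠ 0 := sub_ne_zero.2 hy
            simp only [hg]
            field_simp
          · filter_upwards [self_mem_nhdsWithin] with y hy h0
            exact absurd (inv_eq_zero.1 h0) (sub_ne_zero.2 hy)
      · exact (hgd s hs hsp hsS).congr_of_eventuallyEq (hhg s hsp)
    have hne : ∀ s ∈ rectBoundary a b c d, s ≠ p := fun s hs hsp => hs.2 (hsp ▸ hp)
    have key := ih h res (fun q hq => hS q (Finset.mem_insert_of_mem hq)) hhd (by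
      intro q hq
      have hqp : q ≠ p := fun e => hpS (e ▸ hq)
      have h1 := hres q (Finset.mem_insert_of_mem hq)
      have h2 : Tendsto (fun y : ℂ => (y - q) * (res p * (y - p)⁻¹)) (𝓝[≠] q) (𝓝 0) := by
        have : ContinuousAt (fun y : ℂ => (y - q) * (res p * (y - p)⁻¹)) q :=
          ContinuousAt.mul (by fun_prop) (hinv q hqp).continuousAt
        have := this.tendsto
        simp only [sub_self, zero_mul] at this
        exact this.mono_left nhdsWithin_le_nhds
      have h3 := h1.sub h2
      rw [sub_zero] at h3
      refine h3.congr' ?_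
      filter_upwards [(hhg q hqp).filter_mono nhdsWithin_le_nhds] with y hy
      rw [hy]
      ring)
    have hc1 : ContinuousOn h (rectBoundary a b c d) := fun s hs =>
      (hhd s hs.1 fun hsS => hs.2 (hS s (Finset.mem_insert_of_mem hsS))).continuousAt.continuousWithinAt
    have hc2 : ContinuousOn (fun s : ℂ => res p * (s - p)⁻¹) (rectBoundary a b c d) := fun s hs =>
      (hinv s (hne s hs)).continuousAt.continuousWithinAt
    have hfe : rectIntegral a b c d f =
        rectIntegral a b c d (fun s => h s + res p * (s - p)⁻¹) := by
      refine rectIntegral_congr hab hcd fun s hs => ?_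
      rw [(hhg s (hne s hs)).eq_of_nhds]
      simp [hg]
    rw [hfe, rectIntegral_add hab hcd hc1 hc2, key, rectIntegral_const_mul, rectIntegral_inv_sub hp,
      Finset.sum_insert hpS]
    ring

end Rectangle

/-! ### Residues of the Mellin-Barnes integrand -/

theorem sin_pi_mul_sub_int (w : ℂ) (k : ℤ) :
    Complex.sin (Real.pi * (w - k)) = (-1) ^ k * Complex.sin (Real.pi * w) := by
  have : (Real.pi : ℂ) * (w - k) = Real.pi * w - k * Real.pi := by ring
  rw [this]
  exact k.cast_negOnePow ℂ ▸ Complex.sin_antiperiodic.sub_int_mul_eq k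

/-- By the reflection formula a gamma factor is an entire function divided by a sine, in a form that
is insensitive to the sign of `m`. -/
theorem gammaFactor_eq_div_sin (m : ℤ) (s : ℂ)
    (hs : Complex.sin (Real.pi * (s + m / 2)) ≠ 0) :
    gammaFactor m s = Complex.I ^ m * (2 * (Real.pi : ℂ)) ^ (1 - 2 * s) * Real.pi *
      ((Complex.Gamma (1 - s - m / 2))⁻¹ * (Complex.Gamma (1 - s + m / 2))⁻¹) /
        Complex.sin (Real.pi * (s + m / 2)) := by
  have main : ∀ k : ℕ, Complex.sin (Real.pi * (s + k / 2)) ≠ 0 →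
      Complex.I ^ k * (2 * (Real.pi : ℂ)) ^ (1 - 2 * s) *
        (Complex.Gamma (s + (k : ℂ) / 2) / Complex.Gamma (1 - s + (k : ℂ) / 2)) =
      Complex.I ^ k * (2 * (Real.pi : ℂ)) ^ (1 - 2 * s) * Real.pi *
      ((Complex.Gamma (1 - s - k / 2))⁻¹ * (Complex.Gamma (1 - s + k / 2))⁻¹) /
        Complex.sin (Real.pi * (s + k / 2)) := by
    intro k hk
    have h1 := Complex.Gamma_mul_Gamma_one_sub (s + k / 2)
    have e : 1 - (s + (k : ℂ) / 2) = 1 - s - k / 2 := by ring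
    rw [e] at h1
    have hpi : (Real.pi : ℂ) ≠ 0 := by exact_mod_cast Real.pi_ne_zero
    have hne : Complex.Gamma (1 - s - k / 2) ≠ 0 := fun h0 => by
      rw [h0, mul_zero] at h1
      exact div_ne_zero hpi hk h1.symm
    have h2 : Complex.Gamma (s + (k : ℂ) / 2) =
        Real.pi / Complex.sin (Real.pi * (s + k / 2)) * (Complex.Gamma (1 - s - k / 2))⁻¹ := by
      rw [← h1, mul_assoc, mul_inv_cancel₀ hne, mul_one]
    rw [h2]
    ring
  obtain ⟨k, rfl | rfl⟩ := m.eq_nat_or_neg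
  · have := main k (by simpa using hs)
    simpa [gammaFactor] using this
  · have e : ((-(k : ℤ) : ℤ) : ℂ) = -(k : ℂ) := by simp
    have e3 : Complex.sin (Real.pi * (s + ((-(k : ℤ) : ℤ) : ℂ) / 2)) =
        (-1) ^ k * Complex.sin (Real.pi * (s + k / 2)) := by
      have := sin_pi_mul_sub_int (s + k / 2) k
      rw [zpow_natCast] at this
      rw [← this, e]
      congr 2
      push_cast
      ring
    have e4 : Complex.I ^ (-(k : ℤ)) = (-1) ^ k * Complex.I ^ k := by
      rw [zpow_neg, zpow_natCast, ← inv_pow, Complex.inv_I, neg_pow]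
    have hk2 : Complex.sin (Real.pi * (s + k / 2)) ≠ 0 := fun h0 => hs (by rw [e3, h0, mul_zero])
    have := main k hk2
    unfold gammaFactor
    rw [Int.natAbs_neg, Int.natAbs_natCast, this, e3, e4, e]
    have hm1 : ((-1 : ℂ)) ^ k ≠ 0 := pow_ne_zero _ (by norm_num)
    have e5 : 1 - s - -(k : ℂ) / 2 = 1 - s + k / 2 := by ring
    have e6 : 1 - s + -(k : ℂ) / 2 = 1 - s - k / 2 := by ring
    rw [e5, e6]
    field_simp

theorem IsGenericIndex.sub_ne_int {n : ℕ} {μ : Fin n → ℂ} {m : Fin n → ℤ} (h : IsGenericIndex μ m)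
    {l k : Fin n} (hlk : l ≠ k) (j : ℤ) : μ l - μ k - ((m l - m k : ℤ) : ℂ) / 2 ≠ j := by
  intro hj
  refine h k l hlk.symm ?_
  simp only [indexEquiv]
  rcases abs_cases (m l - m k) with ⟨h1, -⟩ | ⟨h1, -⟩
  · exact ⟨j, by rw [h1]; linear_combination 2 * hj⟩
  · refine ⟨j + (m l - m k), ?_⟩
    rw [h1]
    push_cast at hj ⊢
    linear_combination 2 * hj

theorem IsGenericIndex.sin_ne_zero {n : ℕ} {μ : Fin n → ℂ} {m : Fin n → ℤ}
    (h : IsGenericIndex μ m) {l k : Fin n} (hlk : l ≠ k) :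
    Complex.sin (Real.pi * (μ l - μ k - ((m l - m k : ℤ) : ℂ) / 2)) ≠ 0 := by
  intro h0
  obtain ⟨j, hj⟩ := Complex.sin_eq_zero_iff.1 h0
  refine h.sub_ne_int hlk j ?_
  have hpi : (Real.pi : ℂ) ≠ 0 := by exact_mod_cast Real.pi_ne_zero
  apply mul_left_cancel₀ hpi
  rw [hj]; ring

theorem I_zpow_sub_mul (a b : ℕ) :
    Complex.I ^ ((a : ℤ) - b) * (-1) ^ b = Complex.I ^ (a + b) := by
  have h : (-1 : ℂ) ^ b = Complex.I ^ (2 * b) := by rw [pow_mul, Complex.I_sq]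
  rw [h, ← zpow_natCast, ← zpow_add₀ Complex.I_ne_zero, ← zpow_natCast]
  congr 1
  push_cast
  ring

/-- A nonsingular gamma factor at the pole `μ_l - (a + b) / 2`, where `a - b = m_l + k`. Here `w` is
`μ_l - μ_h` and `q` is `m_l - m_h`, so that `m_h + k = a - b - q`. -/
theorem gammaFactor_at_pole (w : ℂ) (q : ℤ) (a b : ℕ)
    (hs : Complex.sin (Real.pi * (w - q / 2)) ≠ 0) :
    gammaFactor (a - b - q) (w - (a + b) / 2) =
      Real.pi * (Complex.I ^ (-q) * (Complex.sin (Real.pi * (w - q / 2)))⁻¹) *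
      (Complex.I ^ (a + b) * (2 * (Real.pi : ℂ)) ^ (1 - 2 * w + (a + b)) *
        ((Complex.Gamma (-w - q / 2 + a + 1))⁻¹ * (Complex.Gamma (-w + q / 2 + b + 1))⁻¹)) := by
  have e1 : Complex.sin (Real.pi * (w - (a + b) / 2 + (((a : ℤ) - b - q : ℤ) : ℂ) / 2)) =
      (-1) ^ b * Complex.sin (Real.pi * (w - q / 2)) := by
    have := sin_pi_mul_sub_int (w - q / 2) b
    rw [zpow_natCast] at this
    rw [← this]
    congr 2
    push_cast
    ring
  have hm1 : ((-1 : ℂ)) ^ b ≠ 0 := pow_ne_zero _ (by norm_num)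
  rw [gammaFactor_eq_div_sin _ _ (by rw [e1]; exact mul_ne_zero hm1 hs), e1]
  have e2 : 1 - (w - ((a : ℂ) + b) / 2) - (((a : ℤ) - b - q : ℤ) : ℂ) / 2 = -w + q / 2 + b + 1 := by
    push_cast; ring
  have e3 : 1 - (w - ((a : ℂ) + b) / 2) + (((a : ℤ) - b - q : ℤ) : ℂ) / 2 = -w - q / 2 + a + 1 := by
    push_cast; ring
  have e4 : 1 - 2 * (w - ((a : ℂ) + b) / 2) = 1 - 2 * w + (a + b) := by ring
  have e5 : Complex.I ^ ((a : ℤ) - b - q) = Complex.I ^ (-q) * Complex.I ^ ((a : ℤ) - b) := by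
    rw [← zpow_add₀ Complex.I_ne_zero]
    congr 1
    ring
  have e6 : (((-1 : ℂ)) ^ b)⁻¹ = (-1) ^ b := by rw [← inv_pow]; norm_num
  rw [e2, e3, e4, e5, ← I_zpow_sub_mul, div_eq_mul_inv, mul_inv, e6]
  ring

/-- The residue of the singular gamma factor at the pole `c - (a + b) / 2`. -/
theorem tendsto_sub_mul_gammaFactor (c : ℂ) (a b : ℕ) :
    Filter.Tendsto (fun s => (s - (c - (a + b) / 2)) * gammaFactor (a - b) (s - c))
      (𝓝[≠] (c - (a + b) / 2)) (𝓝 (Complex.I ^ (a + b) * (2 * (Real.pi : ℂ)) ^ (1 + ((a : ℂ) + b)) *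
        ((Complex.Gamma (a + 1))⁻¹ * (Complex.Gamma (b + 1))⁻¹))) := by
  set p : ℂ := c - (a + b) / 2 with hp
  have hpi : (Real.pi : ℂ) ≠ 0 := by exact_mod_cast Real.pi_ne_zero
  have h2pi : (2 * (Real.pi : ℂ)) ≠ 0 := mul_ne_zero two_ne_zero hpi
  have hder : HasDerivAt (fun s : ℂ => Complex.sin (Real.pi * (s - p))) Real.pi p := by
    have h1 : HasDerivAt (fun s : ℂ => (Real.pi : ℂ) * (s - p)) Real.pi p := by
      simpa using ((hasDerivAt_id p).sub_const p).const_mul (Real.pi : ℂ)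
    simpa using h1.csin
  have hslope := hasDerivAt_iff_tendsto_slope.1 hder
  have hinv := hslope.inv₀ hpi
  set H : ℂ → ℂ := fun s => Complex.I ^ ((a : ℤ) - b) * (-1) ^ b *
    (2 * (Real.pi : ℂ)) ^ (1 - 2 * (s - c)) * Real.pi *
      ((Complex.Gamma (1 - (s - c) - (((a : ℤ) - b : ℤ) : ℂ) / 2))⁻¹ *
        (Complex.Gamma (1 - (s - c) + (((a : ℤ) - b : ℤ) : ℂ) / 2))⁻¹) with hH
  have hHc : ContinuousAt H p := by
    have g1 : Continuous fun s : ℂ =>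
        (Complex.Gamma (1 - (s - c) - (((a : ℤ) - b : ℤ) : ℂ) / 2))⁻¹ :=
      Complex.differentiable_one_div_Gamma.continuous.comp (by fun_prop)
    have g2 : Continuous fun s : ℂ =>
        (Complex.Gamma (1 - (s - c) + (((a : ℤ) - b : ℤ) : ℂ) / 2))⁻¹ :=
      Complex.differentiable_one_div_Gamma.continuous.comp (by fun_prop)
    have g3 : Continuous fun s : ℂ => (2 * (Real.pi : ℂ)) ^ (1 - 2 * (s - c)) :=
      Continuous.const_cpow (by fun_prop) (Or.inl h2pi)
    exact (((continuous_const.mul g3).mul continuous_const).mul (g1.mul g2)).continuousAt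
  have hlim := (hHc.tendsto.mono_left (nhdsWithin_le_nhds (s := {p}ᶜ))).mul hinv
  have hval : H p * (Real.pi : ℂ)⁻¹ = Complex.I ^ (a + b) *
      (2 * (Real.pi : ℂ)) ^ (1 + ((a : ℂ) + b)) *
        ((Complex.Gamma (a + 1))⁻¹ * (Complex.Gamma (b + 1))⁻¹) := by
    have e2 : 1 - (p - c) - (((a : ℤ) - b : ℤ) : ℂ) / 2 = b + 1 := by rw [hp]; push_cast; ring
    have e3 : 1 - (p - c) + (((a : ℤ) - b : ℤ) : ℂ) / 2 = a + 1 := by rw [hp]; push_cast; ring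
    have e4 : 1 - 2 * (p - c) = 1 + ((a : ℂ) + b) := by rw [hp]; ring
    simp only [hH]
    rw [e2, e3, e4, I_zpow_sub_mul]
    field_simp
  rw [hval] at hlim
  refine hlim.congr' ?_
  filter_upwards [hslope.eventually_ne hpi, self_mem_nhdsWithin] with s hs hsp
  have hsp' : s - p ≠ 0 := sub_ne_zero.2 hsp
  have hsin : slope (fun s : ℂ => Complex.sin (Real.pi * (s - p))) p s =
      (s - p)⁻¹ * Complex.sin (Real.pi * (s - p)) := by
    simp [slope_def_module]
  rw [hsin] at hs ⊢
  have hne : Complex.sin (Real.pi * (s - p)) ≠ 0 := right_ne_zero_of_mul hs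
  have e1 : Complex.sin (Real.pi * (s - c + (((a : ℤ) - b : ℤ) : ℂ) / 2)) =
      (-1) ^ b * Complex.sin (Real.pi * (s - p)) := by
    have := sin_pi_mul_sub_int (s - p) b
    rw [zpow_natCast] at this
    rw [← this, hp]
    congr 2
    push_cast
    ring
  have hm1 : ((-1 : ℂ)) ^ b ≠ 0 := pow_ne_zero _ (by norm_num)
  have e6 : (((-1 : ℂ)) ^ b)⁻¹ = (-1) ^ b := by rw [← inv_pow]; norm_num
  rw [gammaFactor_eq_div_sin _ _ (by rw [e1]; exact mul_ne_zero hm1 hne), e1, div_eq_mul_inv,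
    mul_inv ((-1 : ℂ) ^ b), e6, mul_inv (s - p)⁻¹, inv_inv]
  simp only [hH]
  ring

/-- The connection coefficient does not depend on the sign `ε`. -/
theorem connectionCoeff_eq {n : ℕ} (ε : ℤˣ) (μ : Fin n → ℂ) (m : Fin n → ℤ) (l : Fin n) :
    connectionCoeff ε μ m l = ∏ k ∈ Finset.univ.erase l, (Complex.I ^ (-(m l - m k)) *
      (Complex.sin (Real.pi * (μ l - μ k - ((m l - m k : ℤ) : ℂ) / 2)))⁻¹) := by
  refine Finset.prod_congr rfl fun k _ => ?_
  set q := m l - m k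
  have hneg : ∀ q : ℤ, (-Complex.I) ^ q = Complex.I ^ (-q) := fun q => by
    rw [← Complex.inv_I, inv_zpow, zpow_neg]
  rcases Int.units_eq_one_or ε with rfl | rfl
  · have h1 := sin_pi_mul_sub_int (μ l - μ k + (q : ℂ) / 2) q
    have h2 : μ l - μ k + (q : ℂ) / 2 - q = μ l - μ k - (q : ℂ) / 2 := by ring
    rw [h2] at h1
    have h3 : Complex.I ^ q = (-1) ^ q * Complex.I ^ (-q) := by
      rw [← hneg, ← mul_zpow]; simp
    have h4 : ((-1 : ℂ) ^ q)⁻¹ = (-1) ^ q := by rw [← inv_zpow]; norm_num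
    rw [h1, mul_inv, h4]
    simp only [Units.val_one, Int.cast_one, one_mul]
    rw [h3]
    ring
  · simp only [Units.val_neg, Units.val_one, Int.cast_neg, Int.cast_one, neg_mul, one_mul]
    rw [hneg, ← sub_eq_add_neg]

/-- The `j`-th term of the defining series of `besselFirstKind 1 lam l r ω`. -/
noncomputable def firstKindTerm {n : ℕ} (lam : Fin n → ℂ) (l : Fin n) (r ω : ℝ) (j : ℕ) : ℂ :=
  ((((1 : ℤˣ) : ℤ) : ℂ) * Complex.I ^ n) ^ j * coverPow r ω (n * (-lam l + j)) *
    (∏ k, Complex.Gamma (lam k - lam l + j + 1))⁻¹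

/-- The product of the gamma factors at the pole `μ_l - (a + b) / 2`, sorted into the connection
coefficient and one term from each of the two Bessel series. -/
theorem prod_eq_connectionCoeff {n : ℕ} (hn : 1 ≤ n) {μ : Fin n → ℂ} (hμ : ∑ l, μ l = 0)
    (m : Fin n → ℤ) (ε : ℤˣ) {x : ℝ} (hx : 0 < x) (φ : ℝ) {l : Fin n} {k : ℤ} {a b : ℕ}
    (hk : m l + k = a - b) :
    (∏ h, (Complex.I ^ (a + b) * (2 * (Real.pi : ℂ)) ^ (1 - 2 * (μ l - μ h) + (a + b)) *
        ((Complex.Gamma (-(μ l - μ h) - ((m l - m h : ℤ) : ℂ) / 2 + a + 1))⁻¹ *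
          (Complex.Gamma (-(μ l - μ h) + ((m l - m h : ℤ) : ℂ) / 2 + b + 1))⁻¹))) *
      ((Real.pi : ℂ) ^ (n - 1) * connectionCoeff ε μ m l) *
      (x : ℂ) ^ (-2 * (μ l - (a + b) / 2)) =
    2 * Real.pi * ((2 * (Real.pi : ℂ) ^ 2) ^ (n - 1) * (connectionCoeff ε μ m l *
      (firstKindTerm (fun h => μ h + (m h : ℂ) / 2) l (2 * Real.pi * x ^ ((1 : ℝ) / n)) (φ / n) a *
        firstKindTerm (fun h => μ h - (m h : ℂ) / 2) l (2 * Real.pi * x ^ ((1 : ℝ) / n)) (-φ / n)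
          b))) * Complex.exp (-(k * φ * Complex.I)) := by
  have hpi : (Real.pi : ℂ) ≠ 0 := by exact_mod_cast Real.pi_ne_zero
  have h2pi : (2 * (Real.pi : ℂ)) ≠ 0 := mul_ne_zero two_ne_zero hpi
  have hn0 : (n : ℂ) ≠ 0 := by exact_mod_cast (by omega : n ≠ 0)
  have hx0 : (x : ℂ) ≠ 0 := by exact_mod_cast hx.ne'
  set L : ℂ := Complex.log (2 * Real.pi) with hL
  set X : ℂ := Complex.log x with hX
  have hlogR : ((Real.log (2 * Real.pi * x ^ ((1 : ℝ) / n)) : ℝ) : ℂ) = L + X / n := by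
    rw [Real.log_mul (by positivity) (by positivity), Real.log_rpow hx, hL, hX]
    push_cast [Complex.ofReal_log hx.le, Complex.ofReal_log (by positivity : 0 ≤ 2 * Real.pi)]
    ring
  have hsum : ∑ h, (L * (1 - 2 * (μ l - μ h) + (a + b))) =
      L * (n - 2 * n * μ l + n * (a + b)) := by
    rw [← Finset.mul_sum, Finset.sum_add_distrib, Finset.sum_sub_distrib, ← Finset.mul_sum,
      Finset.sum_sub_distrib, hμ]
    simp
    left
    ring
  have hk' : (k : ℂ) = a - b - m l := by
    have : k = a - b - m l := by linarith
    rw [this]; push_cast; ring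
  have e1 : ∀ h, -(μ l - μ h) - ((m l - m h : ℤ) : ℂ) / 2 + a + 1 =
      (μ h + (m h : ℂ) / 2) - (μ l + (m l : ℂ) / 2) + a + 1 := fun h => by push_cast; ring
  have e2 : ∀ h, -(μ l - μ h) + ((m l - m h : ℤ) : ℂ) / 2 + b + 1 =
      (μ h - (m h : ℂ) / 2) - (μ l - (m l : ℂ) / 2) + b + 1 := fun h => by push_cast; ring
  simp only [e1, e2, firstKindTerm, coverPow, hlogR, Complex.cpow_def_of_ne_zero h2pi,
    Complex.cpow_def_of_ne_zero hx0, ← hL, ← hX, Finset.prod_mul_distrib, ← Complex.exp_sum, hsum,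
    Finset.prod_inv_distrib, Finset.prod_const, Finset.card_univ, Fintype.card_fin]
  set P := ∏ h, Complex.Gamma ((μ h + (m h : ℂ) / 2) - (μ l + (m l : ℂ) / 2) + a + 1)
  set Q := ∏ h, Complex.Gamma ((μ h - (m h : ℂ) / 2) - (μ l - (m l : ℂ) / 2) + b + 1)
  set S := connectionCoeff ε μ m l
  obtain ⟨N, rfl⟩ : ∃ N, n = N + 1 := ⟨n - 1, by omega⟩
  have hpow : (2 * (Real.pi : ℂ)) ^ (N + 1) = Complex.exp (L * (N + 1 : ℕ)) := by
    rw [mul_comm L, Complex.exp_nat_mul, hL, Complex.exp_log h2pi]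
  have hexp : Complex.exp (L * ((N + 1 : ℕ) - 2 * (N + 1 : ℕ) * μ l + (N + 1 : ℕ) * (a + b))) *
      Complex.exp (X * (-2 * (μ l - (a + b) / 2))) =
      (2 * (Real.pi : ℂ)) ^ (N + 1) *
      (Complex.exp ((N + 1 : ℕ) * (-(μ l + (m l : ℂ) / 2) + a) *
        (L + X / (N + 1 : ℕ) + ((φ / (N + 1 : ℕ) : ℝ) : ℂ) * Complex.I)) *
      Complex.exp ((N + 1 : ℕ) * (-(μ l - (m l : ℂ) / 2) + b) *
        (L + X / (N + 1 : ℕ) + ((-φ / (N + 1 : ℕ) : ℝ) : ℂ) * Complex.I)) *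
      Complex.exp (-(k * φ * Complex.I))) := by
    rw [hpow, ← Complex.exp_add, ← Complex.exp_add, ← Complex.exp_add, ← Complex.exp_add, hk']
    congr 1
    push_cast at hn0 ⊢
    field_simp
    ring
  have hI : (Complex.I ^ (a + b)) ^ (N + 1) = (Complex.I ^ (N + 1)) ^ a * (Complex.I ^ (N + 1)) ^ b := by
    rw [← pow_add, ← pow_mul, ← pow_mul, mul_comm]
  have h2 : (2 * (Real.pi : ℂ)) ^ (N + 1) * (Real.pi : ℂ) ^ N =
      2 * Real.pi * (2 * (Real.pi : ℂ) ^ 2) ^ N := by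
    rw [pow_succ', mul_assoc, ← mul_pow]
    congr 2
    ring
  rw [Nat.add_sub_cancel, hI]
  simp only [Units.val_one, Int.cast_one, one_mul]
  set I1 := (Complex.I ^ (N + 1)) ^ a
  set I2 := (Complex.I ^ (N + 1)) ^ b
  set E1 := Complex.exp (L * ((N + 1 : ℕ) - 2 * (N + 1 : ℕ) * μ l + (N + 1 : ℕ) * (a + b)))
  set E2 := Complex.exp (X * (-2 * (μ l - (a + b) / 2)))
  linear_combination (I1 * I2 * P⁻¹ * Q⁻¹ * (Real.pi : ℂ) ^ N * S) * hexp +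
    I1 * I2 * P⁻¹ * Q⁻¹ * S * (Complex.exp ((N + 1 : ℕ) * (-(μ l + (m l : ℂ) / 2) + a) *
        (L + X / (N + 1 : ℕ) + ((φ / (N + 1 : ℕ) : ℝ) : ℂ) * Complex.I)) *
      Complex.exp ((N + 1 : ℕ) * (-(μ l - (m l : ℂ) / 2) + b) *
        (L + X / (N + 1 : ℕ) + ((-φ / (N + 1 : ℕ) : ℝ) : ℂ) * Complex.I)) *
      Complex.exp (-(k * φ * Complex.I))) * h2

/-- The residue of the integrand of index `(μ, m + k e)` at the pole `μ_l - (a + b) / 2`, where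
`a - b = m_l + k`, is a product of the `a`-th and the `b`-th term of two Bessel series of the first
kind. -/
theorem tendsto_sub_mul_mellinIntegrand {n : ℕ} (hn : 1 ≤ n) {μ : Fin n → ℂ} (hμ : ∑ l, μ l = 0)
    {m : Fin n → ℤ} (hgen : IsGenericIndex μ m) (ε : ℤˣ) {x : ℝ} (hx : 0 < x) (φ : ℝ) {l : Fin n}
    {k : ℤ} {a b : ℕ} (hk : m l + k = a - b) :
    Filter.Tendsto (fun s => (s - (μ l - (a + b) / 2)) * mellinIntegrand μ (fun h => m h + k) x s)
      (𝓝[≠] (μ l - (a + b) / 2)) (𝓝 (2 * Real.pi * ((2 * (Real.pi : ℂ) ^ 2) ^ (n - 1) *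
      (connectionCoeff ε μ m l *
      (firstKindTerm (fun h => μ h + (m h : ℂ) / 2) l (2 * Real.pi * x ^ ((1 : ℝ) / n)) (φ / n) a *
        firstKindTerm (fun h => μ h - (m h : ℂ) / 2) l (2 * Real.pi * x ^ ((1 : ℝ) / n)) (-φ / n)
          b))) * Complex.exp (-(k * φ * Complex.I)))) := by
  set p : ℂ := μ l - (a + b) / 2 with hp
  have hx0 : (x : ℂ) ≠ 0 := by exact_mod_cast hx.ne'
  rw [← prod_eq_connectionCoeff hn hμ m ε hx φ hk, ← hp]
  set g : Fin n → ℂ := fun h =>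
    Complex.I ^ (a + b) * (2 * (Real.pi : ℂ)) ^ (1 - 2 * (μ l - μ h) + (a + b)) *
        ((Complex.Gamma (-(μ l - μ h) - ((m l - m h : ℤ) : ℂ) / 2 + a + 1))⁻¹ *
          (Complex.Gamma (-(μ l - μ h) + ((m l - m h : ℤ) : ℂ) / 2 + b + 1))⁻¹) with hg
  have h1 : Filter.Tendsto (fun s => (s - p) * gammaFactor (m l + k) (s - μ l)) (𝓝[≠] p)
      (𝓝 (g l)) := by
    have := tendsto_sub_mul_gammaFactor (μ l) a b
    rw [hk]
    simpa [hg] using this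
  have hmh : ∀ h, m h + k = a - b - (m l - m h) := fun h => by linarith
  have h2 : ∀ h ∈ Finset.univ.erase l, Filter.Tendsto (fun s => gammaFactor (m h + k) (s - μ h))
      (𝓝[≠] p) (𝓝 (Real.pi * (Complex.I ^ (-(m l - m h)) *
      (Complex.sin (Real.pi * (μ l - μ h - ((m l - m h : ℤ) : ℂ) / 2)))⁻¹) * g h)) := by
    intro h hh
    have hlh : l ≠ h := (Finset.ne_of_mem_erase hh).symm
    have hval := gammaFactor_at_pole (μ l - μ h) (m l - m h) a b (hgen.sin_ne_zero hlh)
    have e : μ l - μ h - ((a : ℂ) + b) / 2 = p - μ h := by rw [hp]; ring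
    rw [e, ← hmh] at hval
    rw [← hval]
    refine Filter.Tendsto.mono_left ?_ nhdsWithin_le_nhds
    refine (ContinuousAt.comp (g := gammaFactor (m h + k)) (f := fun s : ℂ => s - μ h)
      (differentiableAt_gammaFactor fun α hα => ?_).continuousAt (by fun_prop)).tendsto
    have hc : ((m h + k : ℤ) : ℂ) = a - b - ((m l - m h : ℤ) : ℂ) := by
      rw [hmh h]; push_cast; ring
    rcases Int.natAbs_eq (m h + k) with hab | hab
    · have hab' : (((m h + k).natAbs : ℕ) : ℂ) = ((m h + k : ℤ) : ℂ) := by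
        conv_rhs => rw [hab]
        rw [Int.cast_natCast]
      refine hgen.sub_ne_int hlh (b - α) ?_
      rw [hab', hc, hp] at hα
      push_cast at hα ⊢
      linear_combination hα
    · have hab' : (((m h + k).natAbs : ℕ) : ℂ) = -((m h + k : ℤ) : ℂ) := by
        conv_rhs => rw [hab]
        rw [Int.cast_neg, Int.cast_natCast, neg_neg]
      refine hgen.sub_ne_int hlh (a - (m l - m h) - α) ?_
      rw [hab', hc, hp] at hα
      push_cast at hα ⊢
      linear_combination hα
  have h3 : Filter.Tendsto (fun s : ℂ => (x : ℂ) ^ (-2 * s)) (𝓝[≠] p) (𝓝 ((x : ℂ) ^ (-2 * p))) :=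
    (Continuous.const_cpow (f := fun s : ℂ => -2 * s) (by fun_prop) (Or.inl hx0)).continuousAt.tendsto.mono_left
      nhdsWithin_le_nhds
  have h4 := (h1.mul (tendsto_finsetProd _ h2)).mul h3
  have hval : g l * (∏ h ∈ Finset.univ.erase l, (Real.pi * (Complex.I ^ (-(m l - m h)) *
      (Complex.sin (Real.pi * (μ l - μ h - ((m l - m h : ℤ) : ℂ) / 2)))⁻¹) * g h)) =
      (∏ h, g h) * ((Real.pi : ℂ) ^ (n - 1) * connectionCoeff ε μ m l) := by
    rw [Finset.prod_mul_distrib, Finset.prod_mul_distrib, ← connectionCoeff_eq ε, Finset.prod_const,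
      Finset.card_erase_of_mem (Finset.mem_univ l), Finset.card_univ, Fintype.card_fin,
      ← Finset.mul_prod_erase _ g (Finset.mem_univ l)]
    ring
  rw [hval] at h4
  refine h4.congr fun s => ?_
  rw [mellinIntegrand, gammaProd, ← Finset.mul_prod_erase _ _ (Finset.mem_univ l)]
  ring

/-! ### Shifting the contour to the left -/

section Shift

open MeasureTheory Filter

theorem contourIntegral_eq_line_add_rectIntegral {f : ℂ → ℂ} {σ : ℝ} (ρ : ℝ) (T : ℝ)
    (h : Integrable fun t : ℝ => f (σ + t * Complex.I)) :
    contourIntegral σ ρ T f =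
      (∫ t : ℝ, f (σ + t * Complex.I)) * Complex.I + rectIntegral σ ρ (-T) T f := by
  have h1 := intervalIntegral.integral_interval_add_Ioi (a := -T) (b := T) h.integrableOn
    h.integrableOn
  have h2 := intervalIntegral.integral_Iic_add_Ioi (b := -T) h.integrableOn h.integrableOn
  have h3 := intervalIntegral.integral_symm (μ := volume) (f := fun r : ℝ => f (r + T * Complex.I))
    σ ρ
  unfold contourIntegral rectIntegral
  rw [← h2, ← h1, h3, intervalIntegral.integral_mul_const, integral_mul_const, integral_mul_const]
  simp only [Complex.ofReal_neg, neg_mul, ← sub_eq_add_neg]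
  ring

variable {n : ℕ} {μ : Fin n → ℂ} {m : Fin n → ℤ} {x : ℝ}

theorem integrable_mellinIntegrand_line (hn : 1 ≤ n) (hx : 0 < x) {σ : ℝ}
    (hσ : σ < 1 / 2 + ((∑ l, μ l).re - 1 / 2) / n)
    (hpole : ∀ l, ∀ α : ℕ, σ ≠ (μ l).re - ((m l).natAbs : ℝ) / 2 - α) :
    Integrable fun t : ℝ => mellinIntegrand μ m x (σ + t * Complex.I) := by
  obtain ⟨C⟩ := BarnesContour.nonempty μ m
  have h := decaysOnTails_mellinIntegrand (m := m) hn hx hσ hσ C.im_lt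
  have hT := C.T_pos hn
  have hmid : IntegrableOn (fun t : ℝ => mellinIntegrand μ m x (σ + t * Complex.I))
      (Set.Icc (-C.T) C.T) := by
    refine (continuousOn_vertical σ fun t _ =>
      differentiableAt_mellinIntegrand hx fun l α hs => hpole l α ?_).integrableOn_Icc
    have := congrArg Complex.re hs
    have e : ((m l).natAbs : ℂ) / 2 = ((((m l).natAbs : ℝ) / 2 : ℝ) : ℂ) := by
      rw [Complex.ofReal_div, Complex.ofReal_ofNat, Complex.ofReal_natCast]
    rw [e] at this
    simpa only [Complex.add_re, Complex.ofReal_re, Complex.mul_re, Complex.I_re, mul_zero,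
      Complex.ofReal_im, Complex.I_im, mul_one, sub_self, add_zero, Complex.sub_re,
      Complex.natCast_re] using this
  rw [← integrableOn_univ]
  refine ((h.integrableOn_Iic.union hmid).union h.integrableOn_Ioi).mono_set fun t _ => ?_
  rcases le_or_gt t (-C.T) with h1 | h1
  · exact Or.inl (Or.inl h1)
  · rcases le_or_gt t C.T with h2 | h2
    · exact Or.inl (Or.inr ⟨h1.le, h2⟩)
    · exact Or.inr h2

theorem norm_gammaFactor_sub_one_le (m : ℤ) {q : ℝ} (hq : 0 < q) (hq1 : q ≤ 1) {w : ℂ}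
    (hw : w.re ≤ -((m.natAbs : ℝ) / 2 + (2 * Real.pi) ^ 2 / q)) :
    ‖gammaFactor m (w - 1)‖ ≤ q * ‖gammaFactor m w‖ := by
  set a : ℝ := (m.natAbs : ℝ) / 2 with ha
  have ha0 : 0 ≤ a := by positivity
  have hac : ((m.natAbs : ℂ) / 2) = (a : ℂ) := by
    rw [ha, Complex.ofReal_div, Complex.ofReal_natCast, Complex.ofReal_ofNat]
  set V : ℝ := (2 * Real.pi) ^ 2 / q with hV
  have hV0 : 0 < V := by positivity
  have hV1 : 1 ≤ V := by
    rw [hV, le_div_iff₀ hq]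
    nlinarith [Real.pi_gt_three]
  have n1 : V ≤ ‖w - 1 + a‖ := by
    have := Complex.abs_re_le_norm (w - 1 + a)
    rw [Complex.add_re, Complex.sub_re, Complex.one_re, Complex.ofReal_re,
      abs_of_nonpos (by linarith)] at this
    linarith
  have n2 : V ≤ ‖1 - w + a‖ := by
    have := Complex.re_le_norm (1 - w + a)
    rw [Complex.add_re, Complex.sub_re, Complex.one_re, Complex.ofReal_re] at this
    linarith
  have z1 : w - 1 + a ≠ 0 := norm_pos_iff.1 (by linarith)
  have z2 : 1 - w + a ≠ 0 := norm_pos_iff.1 (by linarith)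
  have g1 := Complex.Gamma_add_one _ z1
  have g2 := Complex.Gamma_add_one _ z2
  have e1 : w - 1 + a + 1 = w + a := by ring
  have e2 : 1 - w + a + 1 = 1 - (w - 1) + a := by ring
  rw [e1] at g1
  rw [e2] at g2
  rw [norm_gammaFactor, norm_gammaFactor, hac, g1, g2, norm_mul, norm_mul, Complex.sub_re,
    Complex.one_re]
  have e3 : (2 * Real.pi) ^ (1 - 2 * (w.re - 1)) =
      (2 * Real.pi) ^ 2 * (2 * Real.pi) ^ (1 - 2 * w.re) := by
    rw [← Real.rpow_natCast, ← Real.rpow_add (by positivity)]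
    congr 1
    push_cast
    ring
  rw [e3]
  set G1 := ‖Complex.Gamma (w - 1 + a)‖
  set G2 := ‖Complex.Gamma (1 - w + a)‖
  set y1 := ‖w - 1 + a‖
  set y2 := ‖1 - w + a‖
  have hy : (2 * Real.pi) ^ 2 ≤ q * (y1 * y2) := by
    have : V ≤ y1 * y2 := by nlinarith
    rw [hV, div_le_iff₀ hq] at this
    linarith
  have hy1 : 0 < y1 := by linarith
  have hy2 : 0 < y2 := by linarith
  calc (2 * Real.pi) ^ 2 * (2 * Real.pi) ^ (1 - 2 * w.re) * (G1 / (y2 * G2))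
      = (2 * Real.pi) ^ 2 * ((2 * Real.pi) ^ (1 - 2 * w.re) * (G1 / (y2 * G2))) := by ring
    _ ≤ q * (y1 * y2) * ((2 * Real.pi) ^ (1 - 2 * w.re) * (G1 / (y2 * G2))) := by gcongr
    _ = _ := by field_simp

theorem exists_norm_mellinIntegrand_sub_one_le (hn : 1 ≤ n) (μ : Fin n → ℂ) (m : Fin n → ℤ)
    (hx : 0 < x) : ∃ B : ℝ, ∀ s : ℂ, s.re ≤ -B →
      ‖mellinIntegrand μ m x (s - 1)‖ ≤ 1 / 2 * ‖mellinIntegrand μ m x s‖ := by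
  set q : ℝ := min 1 (1 / (2 * x ^ 2)) with hq
  have hq0 : 0 < q := by positivity
  have hq1 : q ≤ 1 := min_le_left _ _
  refine ⟨(2 * Real.pi) ^ 2 / q + ∑ l, (‖μ l‖ + ((m l).natAbs : ℝ) / 2), fun s hs => ?_⟩
  have hx0 : (x : ℂ) ≠ 0 := by exact_mod_cast hx.ne'
  have h1 : ∀ l, ‖gammaFactor (m l) (s - 1 - μ l)‖ ≤ q * ‖gammaFactor (m l) (s - μ l)‖ := by
    intro l
    have e : s - 1 - μ l = s - μ l - 1 := by ring
    rw [e]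
    refine norm_gammaFactor_sub_one_le (m l) hq0 hq1 ?_
    have h2 := Finset.single_le_sum (f := fun l => ‖μ l‖ + ((m l).natAbs : ℝ) / 2)
      (fun _ _ => by positivity) (Finset.mem_univ l)
    have h3 := (abs_le.1 (Complex.abs_re_le_norm (μ l))).1
    rw [Complex.sub_re]
    linarith
  have h2 : ‖(x : ℂ) ^ (-2 * (s - 1))‖ = x ^ 2 * ‖(x : ℂ) ^ (-2 * s)‖ := by
    have e : -2 * (s - 1) = (2 : ℕ) + -2 * s := by push_cast; ring
    rw [e, Complex.cpow_add _ _ hx0, Complex.cpow_natCast, norm_mul, norm_pow, Complex.norm_real,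
      Real.norm_of_nonneg hx.le]
  have h3 : q ^ n * x ^ 2 ≤ 1 / 2 := by
    have h4 : q ^ n ≤ 1 / (2 * x ^ 2) := by
      calc q ^ n ≤ q ^ 1 := pow_le_pow_of_le_one hq0.le hq1 hn
        _ ≤ _ := by rw [pow_one]; exact min_le_right _ _
    calc q ^ n * x ^ 2 ≤ 1 / (2 * x ^ 2) * x ^ 2 := by gcongr
      _ = 1 / 2 := by field_simp
  rw [mellinIntegrand, mellinIntegrand, norm_mul, norm_mul, h2, gammaProd, gammaProd, norm_prod,
    norm_prod]
  calc (∏ l, ‖gammaFactor (m l) (s - 1 - μ l)‖) * (x ^ 2 * ‖(x : ℂ) ^ (-2 * s)‖)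
      ≤ (∏ l, (q * ‖gammaFactor (m l) (s - μ l)‖)) * (x ^ 2 * ‖(x : ℂ) ^ (-2 * s)‖) := by
        gcongr with l
        exact h1 l
    _ = q ^ n * x ^ 2 * ((∏ l, ‖gammaFactor (m l) (s - μ l)‖) * ‖(x : ℂ) ^ (-2 * s)‖) := by
        rw [Finset.prod_mul_distrib, Finset.prod_const, Finset.card_univ, Fintype.card_fin]
        ring
    _ ≤ _ := by gcongr

/-- Once the line is far enough to the left, each unit step halves the `L¹` norm of the integrand. -/
theorem tendsto_integral_line_zero (hn : 1 ≤ n) (hx : 0 < x) {σ : ℝ}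
    (hint : ∀ N : ℕ, Integrable fun t : ℝ =>
      mellinIntegrand μ m x (((σ - N : ℝ) : ℂ) + t * Complex.I)) :
    Tendsto (fun N : ℕ => ∫ t : ℝ, mellinIntegrand μ m x (((σ - N : ℝ) : ℂ) + t * Complex.I))
      atTop (𝓝 0) := by
  obtain ⟨B, hB⟩ := exists_norm_mellinIntegrand_sub_one_le hn μ m hx
  obtain ⟨N₀, hN₀⟩ := exists_nat_ge (σ + B)
  set J : ℕ → ℝ := fun N =>
    ∫ t : ℝ, ‖mellinIntegrand μ m x (((σ - N : ℝ) : ℂ) + t * Complex.I)‖ with hJ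
  have hstep : ∀ j : ℕ, J (j + N₀) ≤ (1 / 2) ^ j * J N₀ := by
    intro j
    induction j with
    | zero => simp
    | succ j ih =>
      have h1 : J (j + 1 + N₀) ≤ 1 / 2 * J (j + N₀) := by
        simp only [hJ]
        rw [← integral_const_mul]
        refine integral_mono (hint _).norm ((hint _).norm.const_mul _) fun t => ?_
        have h2 := hB (((σ - (j + N₀ : ℕ) : ℝ) : ℂ) + t * Complex.I) (by
          have : (0 : ℝ) ≤ j := j.cast_nonneg
          simp
          linarith)
        have e : (((σ - (j + N₀ : ℕ) : ℝ) : ℂ) + t * Complex.I) - 1 =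
            ((σ - (j + 1 + N₀ : ℕ) : ℝ) : ℂ) + t * Complex.I := by push_cast; ring
        rwa [e] at h2
      calc J (j + 1 + N₀) ≤ 1 / 2 * J (j + N₀) := h1
        _ ≤ 1 / 2 * ((1 / 2) ^ j * J N₀) := by gcongr
        _ = _ := by ring
  have hJ0 : Tendsto J atTop (𝓝 0) := by
    rw [← tendsto_add_atTop_iff_nat N₀]
    refine squeeze_zero (fun j => integral_nonneg fun t => norm_nonneg _) hstep ?_
    simpa using (tendsto_pow_atTop_nhds_zero_of_lt_one (by norm_num : (0 : ℝ) ≤ 1 / 2)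
      (by norm_num)).mul_const (J N₀)
  exact squeeze_zero_norm (fun N => norm_integral_le_integral_norm _) hJ0

theorem exists_line_avoiding_poles (μ : Fin n → ℂ) (m : Fin n → ℤ) (c : ℝ) :
    ∃ σ < c, ∀ l, ∀ j : ℤ, σ ≠ (μ l).re - ((m l).natAbs : ℝ) / 2 + j := by
  have hcount : (⋃ l, Set.range fun j : ℤ => (μ l).re - ((m l).natAbs : ℝ) / 2 + j).Countable :=
    Set.countable_iUnion fun l => Set.countable_range _
  obtain ⟨σ, hσ1, hσ2⟩ := (hcount.dense_compl ℝ).exists_lt c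
  exact ⟨σ, hσ2, fun l j h => hσ1 (Set.mem_iUnion.2 ⟨l, j, h.symm⟩)⟩

/-- If the poles of the integrand are simple, the Bessel kernel is the sum of its residues. -/
theorem radialBesselKernel_eq_sum_residues (hn : 1 ≤ n) (hx : 0 < x) (C : BarnesContour μ m)
    (hinj : Function.Injective fun i : (Σ _ : Fin n, ℕ) =>
      μ i.1 - ((m i.1).natAbs : ℂ) / 2 - i.2)
    (res : Fin n → ℕ → ℂ)
    (hres : ∀ l (α : ℕ), Tendsto
      (fun s => (s - (μ l - ((m l).natAbs : ℂ) / 2 - α)) * mellinIntegrand μ m x s)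
      (𝓝[≠] (μ l - ((m l).natAbs : ℂ) / 2 - α)) (𝓝 (res l α)))
    (hsum : ∀ l, Summable (res l)) :
    radialBesselKernel C x = ∑ l, ∑' α, res l α := by
  set P : (Σ _ : Fin n, ℕ) → ℂ := fun i => μ i.1 - ((m i.1).natAbs : ℂ) / 2 - i.2 with hP
  have hPre : ∀ i, (P i).re = (μ i.1).re - ((m i.1).natAbs : ℝ) / 2 - i.2 := fun i => by
    have e : ((m i.1).natAbs : ℂ) / 2 = ((((m i.1).natAbs : ℝ) / 2 : ℝ) : ℂ) := by
      rw [Complex.ofReal_div, Complex.ofReal_ofNat, Complex.ofReal_natCast]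
    simp only [hP]
    rw [e, Complex.sub_re, Complex.sub_re, Complex.ofReal_re, Complex.natCast_re]
  have hPim : ∀ i, (P i).im = (μ i.1).im := fun i => by
    have e : ((m i.1).natAbs : ℂ) / 2 = ((((m i.1).natAbs : ℝ) / 2 : ℝ) : ℂ) := by
      rw [Complex.ofReal_div, Complex.ofReal_ofNat, Complex.ofReal_natCast]
    simp only [hP]
    rw [e, Complex.sub_im, Complex.sub_im, Complex.ofReal_im, Complex.natCast_im, sub_zero, sub_zero]
  -- No line `Re s = σ - N` meets a pole, so the contour may be moved through all of them.
  obtain ⟨σ, hσc, hσp⟩ := exists_line_avoiding_poles μ m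
    (min (1 / 2 + ((∑ l, μ l).re - 1 / 2) / n) C.ρ)
  have hσ1 : σ < 1 / 2 + ((∑ l, μ l).re - 1 / 2) / n := hσc.trans_le (min_le_left _ _)
  have hσ2 : σ < C.ρ := hσc.trans_le (min_le_right _ _)
  have hT := C.T_pos hn
  set y : Fin n → ℝ := fun l => (μ l).re - ((m l).natAbs : ℝ) / 2 - σ with hy
  have hσN : ∀ N : ℕ, σ - N < 1 / 2 + ((∑ l, μ l).re - 1 / 2) / n := fun N => by
    have : (0 : ℝ) ≤ N := N.cast_nonneg
    linarith
  have hint : ∀ N : ℕ, Integrable fun t : ℝ =>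
      mellinIntegrand μ m x (((σ - N : ℝ) : ℂ) + t * Complex.I) := fun N => by
    refine integrable_mellinIntegrand_line hn hx (hσN N) fun l α h => hσp l (N - α) ?_
    push_cast
    linarith
  have key : ∀ N : ℕ, C.integral (mellinIntegrand μ m x) =
      (∫ t : ℝ, mellinIntegrand μ m x (((σ - N : ℝ) : ℂ) + t * Complex.I)) * Complex.I +
        2 * Real.pi * Complex.I * ∑ l, ∑ α ∈ Finset.range ⌈y l + N⌉₊, res l α := by
    intro N
    have hN : (0 : ℝ) ≤ N := N.cast_nonneg
    let C' : BarnesContour μ m := ⟨σ - N, C.ρ, C.T, hσN N, C.re_lt, C.im_lt⟩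
    rw [C.integral_eq_integral hn hx C', C'.integral_eq,
      contourIntegral_eq_line_add_rectIntegral _ _ (hint N)]
    congr 1
    set I : Finset (Σ _ : Fin n, ℕ) := Finset.univ.sigma fun l => Finset.range ⌈y l + N⌉₊ with hI
    have hmemI : ∀ i, i ∈ I ↔ σ - N < (P i).re := fun i => by
      rw [hPre, hI, Finset.mem_sigma, Finset.mem_range, Nat.lt_ceil]
      simp only [Finset.mem_univ, true_and, hy]
      constructor <;> intro h <;> linarith
    have hr := rectIntegral_eq_sum_residues (a := σ - N) (b := C.ρ) (c := -C.T) (d := C.T)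
      (by linarith) (by linarith) (I.image P) (mellinIntegrand μ m x)
      (Function.extend P (fun i => res i.1 i.2) 0) (by
        intro p hp
        obtain ⟨i, hi, rfl⟩ := Finset.mem_image.1 hp
        have h1 := C.re_lt i.1
        rw [← Int.cast_abs, ← Nat.cast_natAbs] at h1
        have h2 : (0 : ℝ) ≤ i.2 := i.2.cast_nonneg
        refine Complex.mem_reProdIm.2 ⟨⟨(hmemI i).1 hi, ?_⟩, ?_⟩
        · rw [hPre]; linarith
        · rw [hPim]; exact abs_lt.1 (C.im_lt i.1)) (by
        intro s hs hsI
        refine differentiableAt_mellinIntegrand hx fun l α hsp => ?_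
        have hsP : s = P ⟨l, α⟩ := hsp
        by_cases hi : (⟨l, α⟩ : Σ _ : Fin n, ℕ) ∈ I
        · exact hsI (Finset.mem_image.2 ⟨_, hi, hsP.symm⟩)
        · rw [hmemI, not_lt, hPre] at hi
          have h1 := (Complex.mem_reProdIm.1 hs).1.1
          rw [hsP, hPre] at h1
          refine hσp l (N - α) ?_
          push_cast
          simp only at h1 hi
          linarith) (by
        intro p hp
        obtain ⟨i, -, rfl⟩ := Finset.mem_image.1 hp
        rw [hinj.extend_apply]
        exact hres i.1 i.2)
    rw [hr, Finset.sum_image fun _ _ _ _ h => hinj h, hI, Finset.sum_sigma]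
    simp only [hinj.extend_apply]
  have hlim : Tendsto (fun N : ℕ => (∫ t : ℝ, mellinIntegrand μ m x (((σ - N : ℝ) : ℂ) +
      t * Complex.I)) * Complex.I + 2 * Real.pi * Complex.I *
        ∑ l, ∑ α ∈ Finset.range ⌈y l + N⌉₊, res l α) atTop
      (𝓝 (0 * Complex.I + 2 * Real.pi * Complex.I * ∑ l, ∑' α, res l α)) := by
    refine ((tendsto_integral_line_zero hn hx hint).mul_const _).add (Tendsto.const_mul _ ?_)
    refine tendsto_finsetSum _ fun l _ => (hsum l).hasSum.tendsto_sum_nat.comp ?_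
    exact tendsto_nat_ceil_atTop.comp
      (tendsto_atTop_add_const_left _ _ tendsto_natCast_atTop_atTop)
  have heq := tendsto_nhds_unique (tendsto_const_nhds.congr fun N => key N) hlim
  have hpi : (Real.pi : ℂ) ≠ 0 := by exact_mod_cast Real.pi_ne_zero
  have hI := Complex.I_ne_zero
  rw [radialBesselKernel, heq]
  field_simp
  ring

end Shift

/-! ### The connection formula for generic indices -/

section Generic

open Filter

/-- Ratio test; the recurrence is written with `1/Γ`, which is entire, so no term has to be nonzero. -/
theorem summable_firstKindTerm {n : ℕ} (lam : Fin n → ℂ) (l : Fin n) (r ω : ℝ) :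
    Summable (firstKindTerm lam l r ω) := by
  set c : ℂ := Complex.I ^ n * coverPow r ω n with hc
  set D : ℕ → ℂ := fun j => ∏ k, (lam k - lam l + j + 1) with hD
  have hrec : ∀ j, firstKindTerm lam l r ω (j + 1) * D j = firstKindTerm lam l r ω j * c := by
    intro j
    have h1 : ∀ k, (Complex.Gamma (lam k - lam l + j + 1))⁻¹ = (lam k - lam l + j + 1) *
        (Complex.Gamma (lam k - lam l + (j + 1 : ℕ) + 1))⁻¹ := fun k => by
      have := Complex.one_div_Gamma_eq_self_mul_one_div_Gamma_add_one (lam k - lam l + j + 1)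
      rw [this]
      congr 3
      push_cast
      ring
    have h2 : coverPow r ω (n * (-lam l + (j + 1 : ℕ))) =
        coverPow r ω (n * (-lam l + j)) * coverPow r ω n := by
      unfold coverPow
      rw [← Complex.exp_add]
      congr 1
      push_cast
      ring
    unfold firstKindTerm
    rw [h2, ← Finset.prod_inv_distrib, ← Finset.prod_inv_distrib, Finset.prod_congr rfl fun k _ => h1 k,
      Finset.prod_mul_distrib, hc, pow_succ]
    simp only [Units.val_one, Int.cast_one, one_mul]
    ring
  have hDlarge : ∀ᶠ j : ℕ in atTop, (j : ℝ) ≤ ‖D j‖ := by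
    obtain ⟨N, hN⟩ := exists_nat_ge (∑ k, ‖lam k - lam l‖)
    filter_upwards [eventually_ge_atTop N] with j hj
    have hj' : (N : ℝ) ≤ j := by exact_mod_cast hj
    have h1 : ∀ k, 1 ≤ ‖lam k - lam l + j + 1‖ := by
      intro k
      have h2 := Finset.single_le_sum (f := fun k => ‖lam k - lam l‖) (fun _ _ => norm_nonneg _)
        (Finset.mem_univ k)
      have h3 := norm_sub_norm_le ((j : ℂ) + 1) (-(lam k - lam l))
      have h4 : ‖(j : ℂ) + 1‖ = j + 1 := by
        rw [← Nat.cast_succ, Complex.norm_natCast, Nat.cast_succ]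
      rw [norm_neg, h4] at h3
      have e : (j : ℂ) + 1 - -(lam k - lam l) = lam k - lam l + j + 1 := by ring
      rw [e] at h3
      linarith
    have h5 : ‖lam l - lam l + j + 1‖ = (j : ℝ) + 1 := by
      rw [sub_self, zero_add, ← Nat.cast_succ, Complex.norm_natCast, Nat.cast_succ]
    simp only [hD]
    rw [norm_prod, ← Finset.mul_prod_erase _ _ (Finset.mem_univ l), h5]
    have h6 : 1 ≤ ∏ k ∈ Finset.univ.erase l, ‖lam k - lam l + j + 1‖ :=
      Finset.one_le_prod fun k _ => h1 k
    nlinarith [(j.cast_nonneg : (0 : ℝ) ≤ j)]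
  refine summable_of_ratio_norm_eventually_le (r := 1 / 2) (by norm_num) ?_
  obtain ⟨M, hM⟩ := exists_nat_ge (2 * ‖c‖)
  filter_upwards [hDlarge, eventually_ge_atTop (M + 1)] with j hj hjM
  have hj2 : (M : ℝ) + 1 ≤ j := by exact_mod_cast hjM
  have hpos : 0 < ‖D j‖ := by
    have : (0 : ℝ) ≤ M := M.cast_nonneg
    linarith
  have h := congrArg norm (hrec j)
  rw [norm_mul, norm_mul] at h
  have h7 : ‖firstKindTerm lam l r ω j‖ * ‖c‖ ≤ ‖firstKindTerm lam l r ω j‖ * (‖D j‖ / 2) := by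
    gcongr
    linarith
  refine le_of_mul_le_mul_right ?_ hpos
  rw [h]
  linarith

/-- The change of summation indices `(k, α) ↦ (a, b)` determined by `a - b = c + k` and
`min a b = α`. -/
def shiftedIntProdNatEquiv (c : ℤ) : ℤ × ℕ ≃ ℕ × ℕ where
  toFun p := (p.2 + (c + p.1).toNat, p.2 + (-(c + p.1)).toNat)
  invFun p := (p.1 - p.2 - c, min p.1 p.2)
  left_inv := by
    rintro ⟨k, α⟩
    ext <;> simp only <;> omega
  right_inv := by
    rintro ⟨a, b⟩
    ext <;> simp only <;> omega

variable {n : ℕ} {μ : Fin n → ℂ} {m : Fin n → ℤ} {x : ℝ}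

theorem injective_poles (hgen : IsGenericIndex μ m) (k : ℤ) :
    Function.Injective fun i : (Σ _ : Fin n, ℕ) =>
      μ i.1 - ((m i.1 + k).natAbs : ℂ) / 2 - i.2 := by
  have hpar : ∀ M : ℤ, ∃ c : ℤ, ((M.natAbs : ℕ) : ℂ) = M + 2 * c := fun M => by
    obtain ⟨k, rfl | rfl⟩ := M.eq_nat_or_neg
    · exact ⟨0, by simp⟩
    · refine ⟨k, ?_⟩
      rw [Int.natAbs_neg, Int.natAbs_natCast]
      push_cast
      ring
  rintro ⟨l, α⟩ ⟨l', α'⟩ h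
  simp only at h
  by_cases hl : l = l'
  · subst hl
    have : (α : ℂ) = α' := by linear_combination -h
    rw [Nat.cast_injective this]
  · obtain ⟨c, hc⟩ := hpar (m l + k)
    obtain ⟨c', hc'⟩ := hpar (m l' + k)
    exfalso
    refine hgen.sub_ne_int hl (c - c' + α - α') ?_
    rw [hc, hc'] at h
    push_cast at h ⊢
    linear_combination h

theorem toNat_sub_toNat_add (M : ℤ) (α : ℕ) :
    M = ((α + M.toNat : ℕ) : ℤ) - ((α + (-M).toNat : ℕ) : ℤ) := by
  push_cast
  omega

theorem toNat_add_toNat_add (M : ℤ) (α : ℕ) (w : ℂ) :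
    w - (((α + M.toNat : ℕ) : ℂ) + ((α + (-M).toNat : ℕ) : ℂ)) / 2 =
      w - (M.natAbs : ℂ) / 2 - α := by
  have : (α + M.toNat) + (α + (-M).toNat) = M.natAbs + 2 * α := by omega
  have h : (((α + M.toNat : ℕ) : ℂ) + ((α + (-M).toNat : ℕ) : ℂ)) = M.natAbs + 2 * α := by
    exact_mod_cast this
  rw [h]
  ring

theorem norm_polar {x : ℝ} (hx : 0 < x) (φ : ℝ) : ‖(x : ℂ) * Complex.exp (φ * Complex.I)‖ = x := by
  rw [norm_mul, Complex.norm_exp_ofReal_mul_I, mul_one, Complex.norm_real, Real.norm_of_nonneg hx.le]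

theorem complexBesselTerm_polar (hx : 0 < x) (φ : ℝ)
    (C : ∀ k : ℤ, BarnesContour μ (fun l => m l + k)) (k : ℤ) :
    complexBesselTerm C (x * Complex.exp (φ * Complex.I)) k =
      1 / (2 * (Real.pi : ℂ)) * radialBesselKernel (C k) x * Complex.exp (k * φ * Complex.I) := by
  have hx0 : (x : ℂ) ≠ 0 := by exact_mod_cast hx.ne'
  rw [complexBesselTerm, norm_polar hx, mul_div_cancel_left₀ _ hx0, ← Complex.exp_int_mul, mul_assoc
    (k : ℂ)]

/-- The connection formula for generic indices, as a statement on the sum over `k`: the residues of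
the Mellin-Barnes integrals, summed over all `k`, rearrange into products of two series. -/
theorem hasSum_complexBesselTerm (hn : 1 ≤ n) (hμ : ∑ l, μ l = 0) (hgen : IsGenericIndex μ m)
    (ε : ℤˣ) (hx : 0 < x) (φ : ℝ) (C : ∀ k : ℤ, BarnesContour μ (fun l => m l + k)) :
    HasSum (complexBesselTerm C (x * Complex.exp (φ * Complex.I))) (connectionRHS ε μ m x φ) := by
  have hpi : (Real.pi : ℂ) ≠ 0 := by exact_mod_cast Real.pi_ne_zero
  set A : Fin n → ℕ → ℂ := fun l => firstKindTerm (fun h => μ h + (m h : ℂ) / 2) l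
    (2 * Real.pi * x ^ ((1 : ℝ) / n)) (φ / n) with hA
  set B : Fin n → ℕ → ℂ := fun l => firstKindTerm (fun h => μ h - (m h : ℂ) / 2) l
    (2 * Real.pi * x ^ ((1 : ℝ) / n)) (-φ / n) with hB
  set K : Fin n → ℂ := fun l => (2 * (Real.pi : ℂ) ^ 2) ^ (n - 1) * connectionCoeff ε μ m l with hK
  -- The double series attached to `l`, first over pairs `(a, b)`, then over pairs `(k, α)`.
  have hprod : ∀ l, HasSum (fun p : ℕ × ℕ => K l * (A l p.1 * B l p.2))
      (K l * ((∑' a, A l a) * ∑' b, B l b)) := fun l => by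
    have sA : Summable fun a => ‖A l a‖ := (summable_firstKindTerm _ _ _ _).norm
    have sB : Summable fun b => ‖B l b‖ := (summable_firstKindTerm _ _ _ _).norm
    have := (summable_mul_of_summable_norm sA sB).hasSum
    rw [← tsum_mul_tsum_of_summable_norm sA sB] at this
    exact this.mul_left _
  have hpair : ∀ l, HasSum (fun p : ℤ × ℕ => K l * (A l (p.2 + (m l + p.1).toNat) *
      B l (p.2 + (-(m l + p.1)).toNat))) (K l * ((∑' a, A l a) * ∑' b, B l b)) := fun l =>
    ((shiftedIntProdNatEquiv (m l)).hasSum_iff (f := fun p : ℕ × ℕ =>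
      K l * (A l p.1 * B l p.2))).2 (hprod l)
  have hfib : ∀ l (k : ℤ), Summable fun α : ℕ => K l * (A l (α + (m l + k).toNat) *
      B l (α + (-(m l + k)).toNat)) := fun l k => (hpair l).summable.prod_factor k
  have hterm : ∀ k, complexBesselTerm C (x * Complex.exp (φ * Complex.I)) k =
      ∑ l, ∑' α : ℕ, K l * (A l (α + (m l + k).toNat) * B l (α + (-(m l + k)).toNat)) := by
    intro k
    have hexp : Complex.exp (-(k * φ * Complex.I)) * Complex.exp (k * φ * Complex.I) = 1 := by
      rw [← Complex.exp_add, neg_add_cancel, Complex.exp_zero]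
    have hrad := radialBesselKernel_eq_sum_residues hn hx (C k) (injective_poles hgen k)
      (fun l α => 2 * Real.pi * Complex.exp (-(k * φ * Complex.I)) *
        (K l * (A l (α + (m l + k).toNat) * B l (α + (-(m l + k)).toNat)))) (by
        intro l α
        have := tendsto_sub_mul_mellinIntegrand hn hμ hgen ε hx φ (toNat_sub_toNat_add (m l + k) α)
        rw [toNat_add_toNat_add] at this
        convert this using 2
        simp only [hK, hA, hB]
        ring) (fun l => (hfib l k).mul_left _)
    rw [complexBesselTerm_polar hx, hrad]
    simp only [tsum_mul_left (a := 2 * (Real.pi : ℂ) * Complex.exp (-(k * φ * Complex.I))),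
      ← Finset.mul_sum]
    field_simp
    rw [mul_comm, ← mul_assoc, mul_comm (Complex.exp _), hexp, one_mul]
  have hsumk : HasSum (fun k => ∑ l, ∑' α : ℕ, K l * (A l (α + (m l + k).toNat) *
      B l (α + (-(m l + k)).toNat))) (∑ l, K l * ((∑' a, A l a) * ∑' b, B l b)) :=
    hasSum_sum fun l _ => (hpair l).prod_fiberwise fun k => (hfib l k).hasSum
  have hrhs : connectionRHS ε μ m x φ = ∑ l, K l * ((∑' a, A l a) * ∑' b, B l b) := by
    rw [connectionRHS, Finset.mul_sum]
    refine Finset.sum_congr rfl fun l _ => ?_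
    exact (mul_assoc _ _ _).symm
  rw [hrhs]
  exact hsumk.congr_fun hterm

end Generic

/-! ### Continuity of the kernel in `μ` -/

section Continuity

open MeasureTheory Filter

variable {n : ℕ} {x R : ℝ}

theorem tendsto_mellinIntegrand_param {μ : Fin n → ℂ} {M : Fin n → ℤ} {s : ℂ}
    (h : ∀ l, (μ l).re - |(M l : ℝ)| / 2 < s.re ∨ |(μ l).im| < |s.im|) :
    Tendsto (fun μ' => mellinIntegrand μ' M x s) (𝓝 μ) (𝓝 (mellinIntegrand μ M x s)) := by
  unfold mellinIntegrand gammaProd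
  refine Tendsto.mul_const _ (tendsto_finsetProd _ fun l _ => ?_)
  have hd : DifferentiableAt ℂ (gammaFactor (M l)) (s - μ l) := by
    refine differentiableAt_gammaFactor fun α hα => ?_
    have e : ((M l).natAbs : ℂ) / 2 = ((|(M l : ℝ)| / 2 : ℝ) : ℂ) := by
      rw [Complex.ofReal_div, Complex.ofReal_ofNat, ← Int.cast_abs, ← Nat.cast_natAbs,
        Complex.ofReal_natCast]
    rw [e] at hα
    have hre := congrArg Complex.re hα
    have him := congrArg Complex.im hα
    simp only [Complex.sub_re, Complex.add_re, Complex.ofReal_re, Complex.natCast_re, Complex.sub_im,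
      Complex.add_im, Complex.ofReal_im, Complex.natCast_im, Complex.neg_re, Complex.neg_im,
      add_zero, neg_zero] at hre him
    have hα0 : (0 : ℝ) ≤ α := α.cast_nonneg
    rcases h l with h | h
    · linarith
    · rw [sub_eq_zero.1 him] at h; exact lt_irrefl _ h
  exact (ContinuousAt.comp (f := fun μ' : Fin n → ℂ => s - μ' l) hd.continuousAt
    (continuous_const.sub (continuous_apply l)).continuousAt).tendsto

/-- A contour that is admissible for all `μ` in the ball of radius `R`. -/
def uniformContour (hn : 1 ≤ n) {μ : Fin n → ℂ} (hμ : ∑ l, μ l = 0) (hR : ‖μ‖ ≤ R) (M : Fin n → ℤ)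
    (ρ : ℝ) (hρ : ∀ l, R + 1 ≤ ρ + |(M l : ℝ)| / 2) : BarnesContour μ M where
  σ := -R - 2
  ρ := ρ
  T := R + 1
  σ_lt := by
    have h0 : 0 ≤ R := (norm_nonneg _).trans hR
    have hn1 : (1 : ℝ) ≤ n := by exact_mod_cast hn
    have h1 : -(1 / 2 : ℝ) ≤ (0 - 1 / 2) / n := by
      rw [le_div_iff₀ (by linarith)]
      linarith
    rw [hμ, Complex.zero_re]
    linarith
  re_lt l := by
    have := (Complex.re_le_norm (μ l)).trans ((norm_le_pi_norm μ l).trans hR)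
    linarith [hρ l]
  im_lt l := by
    have := (Complex.abs_im_le_norm (μ l)).trans ((norm_le_pi_norm μ l).trans hR)
    linarith

/-- Continuity in `μ` of the contour integral, along a contour that is admissible near `μ`. -/
theorem tendsto_contourIntegral_param (hn : 1 ≤ n) (hx : 0 < x) {μ : Fin n → ℂ} (hR : ‖μ‖ < R)
    (M : Fin n → ℤ) (ρ : ℝ) (hρ : ∀ l, R + 1 ≤ ρ + |(M l : ℝ)| / 2) :
    Tendsto (fun μ' => contourIntegral (-R - 2) ρ (R + 1) (mellinIntegrand μ' M x))
      (𝓝[{μ' | ∑ l, μ' l = 0}] μ)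
      (𝓝 (contourIntegral (-R - 2) ρ (R + 1) (mellinIntegrand μ M x))) := by
  set L := 𝓝[{μ' : Fin n → ℂ | ∑ l, μ' l = 0}] μ with hL
  have hR0 : 0 ≤ R := (norm_nonneg _).trans hR.le
  have hn1 : (1 : ℝ) ≤ n := by exact_mod_cast hn
  have hev : ∀ᶠ μ' in L, ∑ l, μ' l = 0 ∧ ‖μ'‖ ≤ R := by
    refine (eventually_mem_nhdsWithin).and ?_
    have : ∀ᶠ μ' in 𝓝 μ, ‖μ'‖ < R := (continuous_norm.tendsto μ).eventually_lt_const hR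
    exact (this.filter_mono nhdsWithin_le_nhds).mono fun _ h => h.le
  set A : ℝ := |-R - 2| + |ρ| with hA
  obtain ⟨C, hC, hb⟩ := exists_norm_mellinIntegrand_le (A := A) M hx hR0 (by positivity) one_pos
  have hint : ∀ᶠ μ' in L, ∃ C' : BarnesContour μ' M, C'.σ = -R - 2 ∧ C'.ρ = ρ ∧ C'.T = R + 1 ∧
      C'.AbsConverges (mellinIntegrand μ' M x) := by
    filter_upwards [hev] with μ' h
    exact ⟨uniformContour hn h.1 h.2 M ρ hρ, rfl, rfl, rfl,
      BarnesContour.absConverges hn hx _⟩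
  have hbound : ∀ᶠ μ' in L, ∀ s : ℂ, |s.re| ≤ A → (R + 1 ≤ |s.im| ∨ s.re = ρ) →
      ‖mellinIntegrand μ' M x s‖ ≤ C * (1 + |s.im|) ^ (2 * n * s.re - n) := by
    filter_upwards [hev] with μ' h s hs hgood
    have h1 := hb μ' (fun l => (norm_le_pi_norm μ' l).trans h.2) s hs fun l => by
      have hn := (norm_le_pi_norm μ' l).trans h.2
      rcases hgood with hg | hg
      · right
        have := abs_sub_abs_le_abs_sub s.im (μ' l).im
        have := (Complex.abs_im_le_norm (μ' l)).trans hn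
        linarith
      · left
        have := (Complex.re_le_norm (μ' l)).trans hn
        have := hρ l
        rw [← Int.cast_abs, ← Nat.cast_natAbs] at this
        rw [hg]
        linarith
    rw [h.1, Complex.zero_re] at h1
    convert h1 using 3
    ring
  have hlim : ∀ s : ℂ, (R + 1 ≤ |s.im| ∨ s.re = ρ) →
      Tendsto (fun μ' => mellinIntegrand μ' M x s) L (𝓝 (mellinIntegrand μ M x s)) := by
    intro s hs
    refine (tendsto_mellinIntegrand_param fun l => ?_).mono_left nhdsWithin_le_nhds
    have hn := (norm_le_pi_norm μ l).trans hR.le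
    rcases hs with hs | hs
    · right
      have := (Complex.abs_im_le_norm (μ l)).trans hn
      linarith
    · left
      have := (Complex.re_le_norm (μ l)).trans hn
      have := hρ l
      linarith
  have hA1 : |-R - 2| ≤ A := by rw [hA]; linarith [abs_nonneg ρ]
  have hA2 : |ρ| ≤ A := by rw [hA]; linarith [abs_nonneg (-R - 2)]
  have hA3 : ∀ r ∈ Set.uIcc (-R - 2) ρ, |r| ≤ A := fun r hr => by
    rcases Set.mem_uIcc.1 hr with h | h
    · exact (abs_le_max_abs_abs h.1 h.2).trans (max_le hA1 hA2)
    · exact (abs_le_max_abs_abs h.1 h.2).trans (max_le hA2 hA1)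
  have htail : Integrable fun t : ℝ => C * (1 + |t|) ^ (2 * n * (-R - 2) - n) :=
    integrable_one_add_abs_rpow C (by nlinarith)
  have hT : |R + 1| = R + 1 := abs_of_nonneg (by linarith)
  have hvert : ∀ (S : Set ℝ) (a : ℝ), MeasurableSet S → |a| ≤ A →
      (∀ t ∈ S, R + 1 ≤ |t| ∨ a = ρ) →
      IntegrableOn (fun t : ℝ => C * (1 + |t|) ^ (2 * n * a - n)) S →
      (∀ᶠ μ' in L, IntegrableOn (fun t : ℝ => mellinIntegrand μ' M x (a + t * Complex.I)) S) →
      Tendsto (fun μ' => ∫ t in S, mellinIntegrand μ' M x (a + t * Complex.I) * Complex.I) L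
        (𝓝 (∫ t in S, mellinIntegrand μ M x (a + t * Complex.I) * Complex.I)) := by
    intro S a hS ha hgood hg hi
    refine tendsto_integral_filter_of_dominated_convergence _
      (hi.mono fun μ' h => (Integrable.mul_const h _).aestronglyMeasurable) ?_ hg ?_
    · filter_upwards [hbound] with μ' h
      filter_upwards [ae_restrict_mem hS] with t ht
      have := h (a + t * Complex.I) (by simpa using ha) (by simpa using hgood t ht)
      simpa using this
    · filter_upwards [ae_restrict_mem hS] with t ht
      exact (hlim _ (by simpa using hgood t ht)).mul_const _
  have hhor : ∀ c : ℝ, |c| = R + 1 → ∀ a b : ℝ, Set.uIcc a b = Set.uIcc (-R - 2) ρ →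
      (∀ᶠ μ' in L, IntervalIntegrable
        (fun r : ℝ => mellinIntegrand μ' M x (r + c * Complex.I)) volume a b) →
      Tendsto (fun μ' => ∫ r in a..b, mellinIntegrand μ' M x (r + c * Complex.I)) L
        (𝓝 (∫ r in a..b, mellinIntegrand μ M x (r + c * Complex.I))) := by
    intro c hc a b hab hi
    refine intervalIntegral.tendsto_integral_filter_of_dominated_convergence
      (fun r => C * (1 + (R + 1)) ^ (2 * n * r - n))
      (hi.mono fun μ' h => h.def'.aestronglyMeasurable) ?_ ?_ ?_
    · filter_upwards [hbound] with μ' h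
      refine Eventually.of_forall fun r hr => ?_
      have := h (r + c * Complex.I) (by simpa using hA3 r (hab ▸ Set.uIoc_subset_uIcc hr))
        (by simp [hc])
      simpa [hc] using this
    · refine Continuous.intervalIntegrable ?_ _ _
      have : (1 + (R + 1)) ≠ 0 := by linarith
      exact continuous_const.mul (Continuous.rpow continuous_const (by fun_prop)
        fun _ => Or.inl this)
    · exact Eventually.of_forall fun r hr => hlim _ (by simp [hc])
  unfold contourIntegral
  refine ((((hvert _ _ measurableSet_Iic hA1 (fun t ht => Or.inl ?_) htail.integrableOn ?_).add
    ?_).add ?_).add ?_).add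
    (hvert _ _ measurableSet_Ioi hA1 (fun t ht => Or.inl ?_) htail.integrableOn ?_)
  · rw [le_abs]; right; linarith [Set.mem_Iic.1 ht]
  · filter_upwards [hint] with μ' h
    obtain ⟨C', h1, h2, h3, h4⟩ := h
    have := h4.1
    rw [h1, h3] at this
    simpa using this
  · have := hhor (-(R + 1)) (by rw [abs_neg, hT]) (-R - 2) ρ rfl (by
      filter_upwards [hint] with μ' h
      obtain ⟨C', h1, h2, h3, h4⟩ := h
      have := h4.2.1
      rw [h1, h2, h3] at this
      simpa only [Complex.ofReal_neg, neg_mul, ← sub_eq_add_neg] using this)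
    simpa only [Complex.ofReal_neg, neg_mul, ← sub_eq_add_neg] using this
  · simp only [intervalIntegral.integral_of_le (by linarith : -(R + 1) ≤ R + 1)]
    refine hvert _ _ measurableSet_Ioc hA2 (fun t ht => Or.inr rfl) ?_ ?_
    · refine (Continuous.integrableOn_Icc ?_).mono_set Set.Ioc_subset_Icc_self
      exact continuous_const.mul (Continuous.rpow_const (by fun_prop)
        fun t => Or.inl (by positivity))
    · filter_upwards [hint] with μ' h
      obtain ⟨C', h1, h2, h3, h4⟩ := h
      have := h4.2.2.1
      rw [h2, h3, intervalIntegrable_iff_integrableOn_Ioc_of_le (by linarith)] at this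
      exact this
  · refine hhor (R + 1) hT ρ (-R - 2) (Set.uIcc_comm _ _) ?_
    filter_upwards [hint] with μ' h
    obtain ⟨C', h1, h2, h3, h4⟩ := h
    have := h4.2.2.2.1
    rw [h1, h2, h3] at this
    simpa using this
  · exact (le_of_lt ht).trans (le_abs_self t)
  · filter_upwards [hint] with μ' h
    obtain ⟨C', h1, h2, h3, h4⟩ := h
    have := h4.2.2.2.2
    rw [h1, h3] at this
    simpa using this

/-- For large weights the contour may be taken to be a vertical line; the integral is then of order
`|M|⁻²`, uniformly in `μ`. -/
theorem exists_norm_contourIntegral_le (hn : 1 ≤ n) (hx : 0 < x) (hR0 : 0 ≤ R) :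
    ∃ B : ℝ, 0 < B ∧ ∀ (M : Fin n → ℤ) (l₀ : Fin n) (μ : Fin n → ℂ), ∑ l, μ l = 0 → ‖μ‖ ≤ R →
      (∀ l, 2 * R + 3 ≤ |(M l : ℝ)| / 2) →
      ‖contourIntegral (-R - 2) (-R - 2) (R + 1) (mellinIntegrand μ M x)‖ ≤
        B * ((|(M l₀ : ℝ)| / 2 - (2 * R + 2)) ^ 2)⁻¹ := by
  obtain ⟨C, hC, hb⟩ := exists_norm_gammaFactor_le_of_large (2 * R + 2)
  set E : ℝ := Real.exp (2 * (R + 2) * |Real.log x|) with hE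
  refine ⟨C ^ n * E * Real.pi, by positivity, fun M l₀ μ hμ hμR hM => ?_⟩
  have hnat : ∀ l, ((M l).natAbs : ℝ) = |(M l : ℝ)| := fun l => by
    rw [← Int.cast_abs, ← Nat.cast_natAbs]
  have hre : ∀ l, |(μ l).re| ≤ R := fun l =>
    (Complex.abs_re_le_norm (μ l)).trans ((norm_le_pi_norm μ l).trans hμR)
  have hint : Integrable fun t : ℝ =>
      mellinIntegrand μ M x (((-R - 2 : ℝ) : ℂ) + t * Complex.I) := by
    let C' := uniformContour hn hμ hμR M (-R - 2) fun l => by linarith [hM l]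
    refine integrable_mellinIntegrand_line hn hx C'.σ_lt fun l α h => ?_
    have h1 := (abs_le.1 (hre l)).2
    have h2 : (0 : ℝ) ≤ α := α.cast_nonneg
    rw [hnat] at h
    linarith [hM l]
  set W : ℝ := ((|(M l₀ : ℝ)| / 2 - (2 * R + 2)) ^ 2)⁻¹ with hW
  have hpt : ∀ t : ℝ, ‖mellinIntegrand μ M x (((-R - 2 : ℝ) : ℂ) + t * Complex.I)‖ ≤
      C ^ n * E * W * (1 + (t - (μ l₀).im) ^ 2)⁻¹ := by
    intro t
    set s : ℂ := ((-R - 2 : ℝ) : ℂ) + t * Complex.I with hs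
    have hsre : s.re = -R - 2 := by simp [hs]
    have hsim : s.im = t := by simp [hs]
    have hf : ∀ l, ‖gammaFactor (M l) (s - μ l)‖ ≤
        C * ((|(M l : ℝ)| / 2 - (2 * R + 2)) ^ 2)⁻¹ * (1 + (t - (μ l).im) ^ 2)⁻¹ := by
      intro l
      have h1 := abs_le.1 (hre l)
      have h2 := hb (M l) (s - μ l) (by
        rw [Complex.sub_re, hsre, abs_le]; constructor <;> linarith)
        (by rw [Complex.sub_re, hsre]; linarith) (by rw [hnat]; linarith [hM l])
      rwa [hnat, Complex.sub_im, hsim] at h2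
    have hf1 : ∀ l, ‖gammaFactor (M l) (s - μ l)‖ ≤ C := by
      intro l
      refine (hf l).trans ?_
      have h1 : ((|(M l : ℝ)| / 2 - (2 * R + 2)) ^ 2)⁻¹ ≤ 1 := by
        apply inv_le_one_of_one_le₀
        have := hM l
        nlinarith
      have h2 : (1 + (t - (μ l).im) ^ 2)⁻¹ ≤ 1 := by
        apply inv_le_one_of_one_le₀
        nlinarith [sq_nonneg (t - (μ l).im)]
      calc _ ≤ C * 1 * 1 := by gcongr
        _ = C := by ring
    have hx1 := norm_ofReal_cpow_neg_two_mul_le hx (A := R + 2) (s := s) (by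
      rw [hsre, abs_le]; constructor <;> linarith)
    rw [mellinIntegrand, norm_mul, gammaProd, norm_prod,
      ← Finset.mul_prod_erase _ _ (Finset.mem_univ l₀)]
    have h3 : ∏ l ∈ Finset.univ.erase l₀, ‖gammaFactor (M l) (s - μ l)‖ ≤ C ^ (n - 1) := by
      refine (Finset.prod_le_prod (fun _ _ => norm_nonneg _) fun l _ => hf1 l).trans ?_
      rw [Finset.prod_const, Finset.card_erase_of_mem (Finset.mem_univ _), Finset.card_univ,
        Fintype.card_fin]
    have h4 : C ^ n = C * C ^ (n - 1) := by
      rw [← pow_succ', Nat.sub_add_cancel hn]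
    calc _ ≤ C * W * (1 + (t - (μ l₀).im) ^ 2)⁻¹ * C ^ (n - 1) * E := by
          refine mul_le_mul (mul_le_mul (hf l₀) h3 ?_ ?_) hx1 (norm_nonneg _) ?_
          · exact Finset.prod_nonneg fun _ _ => norm_nonneg _
          · positivity
          · positivity
      _ = _ := by rw [h4]; ring
  rw [contourIntegral_eq_line_add_rectIntegral _ _ hint]
  have hrect : rectIntegral (-R - 2) (-R - 2) (-(R + 1)) (R + 1) (mellinIntegrand μ M x) = 0 := by
    simp [rectIntegral]
  rw [hrect, add_zero, norm_mul, Complex.norm_I, mul_one]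
  refine (norm_integral_le_integral_norm _).trans ?_
  have hg : Integrable fun t : ℝ => C ^ n * E * W * (1 + (t - (μ l₀).im) ^ 2)⁻¹ :=
    (integrable_inv_one_add_sq.comp_sub_right (μ l₀).im).const_mul _
  refine (integral_mono hint.norm hg hpt).trans ?_
  rw [integral_const_mul, integral_sub_right_eq_self (fun t : ℝ => (1 + t ^ 2)⁻¹),
    integral_univ_inv_one_add_sq]
  apply le_of_eq
  ring

end Continuity

section Limit

open Filter

variable {n : ℕ} {x R : ℝ}

/-- The term of the kernel computed with the contour parameters `-R - 2`, `ρ`, `R + 1`. -/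
noncomputable def uniformTerm (R : ℝ) (ρ : ℝ) (μ : Fin n → ℂ) (M : Fin n → ℤ) (x φ : ℝ) (k : ℤ) :
    ℂ :=
  1 / (2 * (Real.pi : ℂ)) * (1 / (2 * (Real.pi : ℂ) * Complex.I) *
    contourIntegral (-R - 2) ρ (R + 1) (mellinIntegrand μ M x)) * Complex.exp (k * φ * Complex.I)

theorem complexBesselTerm_eq_uniformTerm (hn : 1 ≤ n) (hx : 0 < x) {μ : Fin n → ℂ}
    (hμ : ∑ l, μ l = 0) (hR : ‖μ‖ ≤ R) {m : Fin n → ℤ}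
    (C : ∀ k : ℤ, BarnesContour μ (fun l => m l + k)) (φ : ℝ) (k : ℤ) {ρ : ℝ}
    (hρ : ∀ l, R + 1 ≤ ρ + |((m l + k : ℤ) : ℝ)| / 2) :
    complexBesselTerm C (x * Complex.exp (φ * Complex.I)) k =
      uniformTerm R ρ μ (fun l => m l + k) x φ k := by
  rw [complexBesselTerm_polar hx,
    radialBesselKernel_eq hn hx (C k) (uniformContour hn hμ hR (fun l => m l + k) ρ hρ)]
  rfl

theorem tendsto_uniformTerm (hn : 1 ≤ n) (hx : 0 < x) {μ : Fin n → ℂ} (hR : ‖μ‖ < R)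
    (M : Fin n → ℤ) {ρ : ℝ} (hρ : ∀ l, R + 1 ≤ ρ + |(M l : ℝ)| / 2) (φ : ℝ) (k : ℤ) :
    Tendsto (fun μ' => uniformTerm R ρ μ' M x φ k) (𝓝[{μ' | ∑ l, μ' l = 0}] μ)
      (𝓝 (uniformTerm R ρ μ M x φ k)) :=
  (((tendsto_contourIntegral_param hn hx hR M ρ hρ).const_mul _).const_mul _).mul_const _

/-- Beyond a threshold depending only on `m` and `R` the terms of the kernel are of order `k⁻²`. -/
theorem exists_norm_uniformTerm_le (hn : 1 ≤ n) (hx : 0 < x) (hR0 : 0 ≤ R) (m : Fin n → ℤ) (φ : ℝ) :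
    ∃ B K : ℝ, 0 < B ∧ ∀ k : ℤ, K ≤ |(k : ℝ)| →
      (∀ l, R + 1 ≤ -R - 2 + |((m l + k : ℤ) : ℝ)| / 2) ∧
      ∀ μ : Fin n → ℂ, ∑ l, μ l = 0 → ‖μ‖ ≤ R →
        ‖uniformTerm R (-R - 2) μ (fun l => m l + k) x φ k‖ ≤ B * (1 / (k : ℝ) ^ 2) := by
  obtain ⟨B, hB, hb⟩ := exists_norm_contourIntegral_le (n := n) hn hx hR0
  have hpi := Real.pi_pos
  refine ⟨1 / (2 * Real.pi) * (1 / (2 * Real.pi) * (B * 16)),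
    2 * ∑ l, |(m l : ℝ)| + 4 * (2 * R + 3), by positivity, fun k hk => ?_⟩
  have hml : ∀ l, |(m l : ℝ)| ≤ ∑ l, |(m l : ℝ)| := fun l =>
    Finset.single_le_sum (f := fun l => |(m l : ℝ)|) (fun _ _ => abs_nonneg _) (Finset.mem_univ l)
  have habs : ∀ l, |(k : ℝ)| / 4 + (2 * R + 3) ≤ |((m l + k : ℤ) : ℝ)| / 2 := fun l => by
    have h1 := abs_sub_abs_le_abs_sub (k : ℝ) (-(m l : ℝ))
    have e : (k : ℝ) - -(m l : ℝ) = ((m l + k : ℤ) : ℝ) := by push_cast; ring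
    rw [abs_neg, e] at h1
    have := hml l
    linarith
  have hk0 : 0 < |(k : ℝ)| := by
    have : (0 : ℝ) ≤ ∑ l, |(m l : ℝ)| := Finset.sum_nonneg fun _ _ => abs_nonneg _
    linarith
  refine ⟨fun l => by linarith [habs l], fun μ hμ hμR => ?_⟩
  have h1 := hb (fun l => m l + k) ⟨0, hn⟩ μ hμ hμR fun l => by linarith [habs l]
  have h2 : ((|((m ⟨0, hn⟩ + k : ℤ) : ℝ)| / 2 - (2 * R + 2)) ^ 2)⁻¹ ≤ 16 * (1 / (k : ℝ) ^ 2) := by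
    have h3 : (|(k : ℝ)| / 4) ^ 2 ≤ (|((m ⟨0, hn⟩ + k : ℤ) : ℝ)| / 2 - (2 * R + 2)) ^ 2 := by
      have := habs ⟨0, hn⟩
      gcongr
      linarith
    calc _ ≤ ((|(k : ℝ)| / 4) ^ 2)⁻¹ := inv_anti₀ (by positivity) h3
      _ = _ := by
        rw [div_pow, sq_abs]
        field_simp
        norm_num
  have hexp : ‖Complex.exp (k * φ * Complex.I)‖ = 1 := by
    have : (k : ℂ) * φ = ((k * φ : ℝ) : ℂ) := by push_cast; ring
    rw [this, Complex.norm_exp_ofReal_mul_I]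
  have hc1 : ‖1 / (2 * (Real.pi : ℂ))‖ = 1 / (2 * Real.pi) := by
    rw [norm_div, norm_mul, norm_one, Complex.norm_real, Real.norm_of_nonneg hpi.le]; simp
  have hc2 : ‖1 / (2 * (Real.pi : ℂ) * Complex.I)‖ = 1 / (2 * Real.pi) := by
    rw [norm_div, norm_mul, norm_mul, norm_one, Complex.norm_real, Real.norm_of_nonneg hpi.le]; simp
  unfold uniformTerm
  rw [norm_mul, norm_mul, norm_mul, hexp, hc1, hc2, mul_one]
  calc _ ≤ 1 / (2 * Real.pi) * (1 / (2 * Real.pi) * (B * (16 * (1 / (k : ℝ) ^ 2)))) := by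
        gcongr
        exact h1.trans (by gcongr)
    _ = _ := by ring

theorem finite_abs_lt (K : ℝ) : {k : ℤ | |(k : ℝ)| < K}.Finite := by
  refine (Set.finite_Icc (-⌈K⌉) ⌈K⌉).subset fun k hk => ?_
  have h1 : |(k : ℝ)| < K := hk
  have h2 := abs_lt.1 (h1.trans_le (Int.le_ceil K))
  exact ⟨by exact_mod_cast h2.1.le, by exact_mod_cast h2.2.le⟩

/-- The series defining the kernel converges absolutely and depends continuously on `μ`. -/
theorem summable_and_tendsto_complexBesselKernel (hn : 1 ≤ n) (hx : 0 < x) {μ : Fin n → ℂ}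
    (hμ : ∑ l, μ l = 0) (m : Fin n → ℤ) (C : ∀ (μ' : Fin n → ℂ) (k : ℤ),
      BarnesContour μ' (fun l => m l + k)) (φ : ℝ) :
    Summable (complexBesselTerm (C μ) (x * Complex.exp (φ * Complex.I))) ∧
    Tendsto (fun μ' => complexBesselKernel (C μ') (x * Complex.exp (φ * Complex.I)))
      (𝓝[{μ' | ∑ l, μ' l = 0}] μ)
      (𝓝 (complexBesselKernel (C μ) (x * Complex.exp (φ * Complex.I)))) := by
  set z : ℂ := x * Complex.exp (φ * Complex.I) with hz
  set R : ℝ := ‖μ‖ + 1 with hRdef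
  have hR : ‖μ‖ < R := by linarith
  have hR0 : 0 ≤ R := by positivity
  set L := 𝓝[{μ' : Fin n → ℂ | ∑ l, μ' l = 0}] μ with hL
  obtain ⟨B, K, hB, hb⟩ := exists_norm_uniformTerm_le hn hx hR0 m φ
  have hev : ∀ᶠ μ' in L, ∑ l, μ' l = 0 ∧ ‖μ'‖ ≤ R := by
    refine (eventually_mem_nhdsWithin).and ?_
    have : ∀ᶠ μ' in 𝓝 μ, ‖μ'‖ < R := (continuous_norm.tendsto μ).eventually_lt_const hR
    exact (this.filter_mono nhdsWithin_le_nhds).mono fun _ h => h.le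
  have hlarge : ∀ k : ℤ, K ≤ |(k : ℝ)| → ∀ μ' : Fin n → ℂ, ∑ l, μ' l = 0 → ‖μ'‖ ≤ R →
      ‖complexBesselTerm (C μ') z k‖ ≤ B * (1 / (k : ℝ) ^ 2) := fun k hk μ' h0 h1 => by
    rw [hz, complexBesselTerm_eq_uniformTerm hn hx h0 h1 (C μ') φ k (hb k hk).1]
    exact (hb k hk).2 μ' h0 h1
  have hlim : ∀ k : ℤ, Tendsto (fun μ' => complexBesselTerm (C μ') z k) L
      (𝓝 (complexBesselTerm (C μ) z k)) := fun k => by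
    have hρ : ∀ l, R + 1 ≤ R + 1 + |((m l + k : ℤ) : ℝ)| / 2 := fun l => by
      linarith [abs_nonneg ((m l + k : ℤ) : ℝ)]
    rw [hz, complexBesselTerm_eq_uniformTerm hn hx hμ hR.le (C μ) φ k hρ]
    refine (tendsto_uniformTerm hn hx hR (fun l => m l + k) hρ φ k).congr' ?_
    filter_upwards [hev] with μ' h
    rw [complexBesselTerm_eq_uniformTerm hn hx h.1 h.2 (C μ') φ k hρ]
  have hsq : Summable fun k : ℤ => B * (1 / (k : ℝ) ^ 2) :=
    (Real.summable_one_div_int_pow.2 one_lt_two).mul_left B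
  have hcof : ∀ᶠ k : ℤ in cofinite, K ≤ |(k : ℝ)| := by
    have := (finite_abs_lt K).eventually_cofinite_notMem
    filter_upwards [this] with k hk
    exact not_lt.1 hk
  have hsum : Summable (complexBesselTerm (C μ) z) := by
    refine Summable.of_norm_bounded_eventually hsq ?_
    filter_upwards [hcof] with k hk
    exact hlarge k hk μ hμ hR.le
  -- For the finitely many small `k` the terms are bounded near `μ` because they converge.
  have hbd : Summable fun k : ℤ => if K ≤ |(k : ℝ)| then B * (1 / (k : ℝ) ^ 2) else
      ‖complexBesselTerm (C μ) z k‖ + 1 := by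
    refine hsq.congr_cofinite ?_
    filter_upwards [hcof] with k hk
    rw [if_pos hk]
  have hdom : ∀ᶠ μ' in L, ∀ k : ℤ, ‖complexBesselTerm (C μ') z k‖ ≤
      if K ≤ |(k : ℝ)| then B * (1 / (k : ℝ) ^ 2) else ‖complexBesselTerm (C μ) z k‖ + 1 := by
    have hsmall : ∀ᶠ μ' in L, ∀ k ∈ {k : ℤ | |(k : ℝ)| < K},
        ‖complexBesselTerm (C μ') z k‖ < ‖complexBesselTerm (C μ) z k‖ + 1 :=
      (eventually_all_finite (finite_abs_lt K)).2 fun k _ =>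
        (hlim k).norm.eventually_lt_const (lt_add_one _)
    filter_upwards [hev, hsmall] with μ' h h' k
    split_ifs with hk
    · exact hlarge k hk μ' h.1 h.2
    · exact (h' k (not_le.1 hk)).le
  exact ⟨hsum, tendsto_tsum_of_dominated_convergence hbd hlim hdom⟩

end Limit

/-! ### Density of generic indices -/

/-- Generic indices are dense in the hyperplane `∑ μ_l = 0`: the line through `μ` in a direction with
pairwise distinct coordinates of sum `0` meets the non-generic set in a countable set. -/
theorem neBot_nhdsWithin_genericSet {μ : Fin n → ℂ} (hμ : ∑ l, μ l = 0) (m : Fin n → ℤ) :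
    (𝓝[genericSet m] μ).NeBot := by
  rw [← mem_closure_iff_nhdsWithin_neBot]
  set v : Fin n → ℂ := fun l => (l : ℂ) - (∑ k : Fin n, (k : ℂ)) / n with hv
  have hvsum : ∑ l, v l = 0 := by
    rcases Nat.eq_zero_or_pos n with rfl | hn
    · simp
    · have : (n : ℂ) ≠ 0 := by exact_mod_cast hn.ne'
      simp only [hv, Finset.sum_sub_distrib, Finset.sum_const, Finset.card_univ, Fintype.card_fin,
        nsmul_eq_mul]
      field_simp
      ring
  have hvne : ∀ l k, l ≠ k → v k - v l ≠ 0 := fun l k hlk h => by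
    apply hlk
    have : (l : ℂ) = (k : ℂ) := by
      simp only [hv] at h
      linear_combination -h
    exact Fin.ext (by exact_mod_cast this)
  have hcount : (⋃ l : Fin n, ⋃ k : Fin n, Set.range fun j : ℤ =>
      ((2 * (j : ℂ) + ((|m k - m l| : ℤ) : ℂ) - 2 * μ k + 2 * μ l) / (2 * (v k - v l))).re).Countable :=
    Set.countable_iUnion fun l => Set.countable_iUnion fun k => Set.countable_range _
  have hdense := hcount.dense_compl ℝ
  have hcont : Continuous fun t : ℝ => fun l => μ l + t * v l := by fun_prop
  have h0 : (0 : ℝ) ∈ closure (⋃ l : Fin n, ⋃ k : Fin n, Set.range fun j : ℤ =>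
      ((2 * (j : ℂ) + ((|m k - m l| : ℤ) : ℂ) - 2 * μ k + 2 * μ l) / (2 * (v k - v l))).re)ᶜ :=
    hdense 0
  have h1 := map_mem_closure hcont h0 (t := genericSet m) (by
    intro t ht
    refine ⟨?_, fun l k hlk hj => ht ?_⟩
    · rw [Finset.sum_add_distrib, ← Finset.mul_sum, hμ, hvsum, mul_zero, add_zero]
    · obtain ⟨j, hj⟩ := hj
      refine Set.mem_iUnion.2 ⟨l, Set.mem_iUnion.2 ⟨k, j, ?_⟩⟩
      simp only at hj ⊢
      have : (2 * (j : ℂ) + ((|m k - m l| : ℤ) : ℂ) - 2 * μ k + 2 * μ l) / (2 * (v k - v l)) = t := by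
        rw [div_eq_iff (mul_ne_zero two_ne_zero (hvne l k hlk))]
        linear_combination -hj
      rw [this, Complex.ofReal_re])
  simpa using h1

/-! ### The connection formula -/

theorem mainTheorem2 (n : ℕ) (hn : 1 ≤ n) (μ : Fin n → ℂ) (hμ : ∑ l, μ l = 0) (m : Fin n → ℤ)
    (C : ∀ k : ℤ, BarnesContour μ (fun l => m l + k)) (ε : ℤˣ) (x φ : ℝ) (hx : 0 < x) :
    -- the integrals and the series that define the kernel converge absolutely
    (∀ k : ℤ, (C k).AbsConverges (mellinIntegrand μ (fun l => m l + k) x)) ∧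
    Summable (complexBesselTerm C (x * Complex.exp (φ * Complex.I))) ∧
    -- generic indices
    (IsGenericIndex μ m →
      complexBesselKernel C (x * Complex.exp (φ * Complex.I)) = connectionRHS ε μ m x φ ∧
      ∀ j : ℤ, connectionRHS ε μ m x (φ + 2 * Real.pi * j) = connectionRHS ε μ m x φ) ∧
    -- arbitrary indices: the right hand side is read as a limit along generic indices
    (𝓝[genericSet m] μ).NeBot ∧
    Filter.Tendsto (fun μ' => connectionRHS ε μ' m x φ) (𝓝[genericSet m] μ)
      (𝓝 (complexBesselKernel C (x * Complex.exp (φ * Complex.I)))) := by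
  classical
  -- A family of contours for all `μ'` that extends the given one.
  let C' : ∀ (μ' : Fin n → ℂ) (k : ℤ), BarnesContour μ' (fun l => m l + k) := fun μ' k =>
    if h : μ = μ' then h ▸ C k else (BarnesContour.nonempty μ' _).some
  have hC' : C' μ = C := by
    funext k
    simp [C']
  obtain ⟨hsum, hlim⟩ := summable_and_tendsto_complexBesselKernel hn hx hμ m C' φ
  rw [hC'] at hsum hlim
  refine ⟨fun k => (C k).absConverges hn hx, hsum, fun hgen => ?_, neBot_nhdsWithin_genericSet hμ m,
    ?_⟩
  · have hformula : ∀ ψ : ℝ, complexBesselKernel C (x * Complex.exp (ψ * Complex.I)) =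
        connectionRHS ε μ m x ψ := fun ψ =>
      (hasSum_complexBesselTerm hn hμ hgen ε hx ψ C).tsum_eq
    refine ⟨hformula φ, fun j => ?_⟩
    rw [← hformula, ← hformula]
    congr 2
    have : ((φ + 2 * Real.pi * j : ℝ) : ℂ) * Complex.I =
        φ * Complex.I + j * (2 * Real.pi * Complex.I) := by push_cast; ring
    rw [this, Complex.exp_add, Complex.exp_int_mul_two_pi_mul_I, mul_one]
  · refine (hlim.mono_left (nhdsWithin_mono μ fun μ' h => h.1)).congr' ?_
    filter_upwards [self_mem_nhdsWithin] with μ' h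
    exact (hasSum_complexBesselTerm hn h.1 h.2 ε hx φ (C' μ')).tsum_eq
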